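/- Let $G$ be a group with $|G| = 112$ whose Sylow $7$-subgroups are not normal. Then every connected Cayley graph on $G$ has a hamiltonian cycle. That is, for every subset $S \subseteq G$ such that the Cayley graph $\mathrm{Cay}(G;S)$ is connected (equivalently, $S$ generates $G$), there is a cycle in $\mathrm{Cay}(G;S)$ that visits every vertex exactly once. Here $\mathrm{Cay}(G;S)$ is the simple undirected graph with vertex set $G$ in which distinct $g, h \in G$ are adjacent if and only if $g^{-1}h \in S \cup S^{-1}$. -/

import Mathlib

/-! The hypotheses nearly determine `G`: it is `(𝔽₈ × 𝔽₂) ⋊ C₇`, with a generator of `C₇`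
multiplying `𝔽₈` by a root of `α³ = 1 + α` and fixing `𝔽₂`. The theorem thus becomes a finite check
on explicit words.

Structure. A subgroup `⟨b⟩` of order 7 has a normalizer of order 14, hence is normalized by an
involution that centralizes or inverts it. Sylow theory yields a normal subgroup of order 8 or 16.
On a normal subgroup of order 8, `b` permutes the seven nontrivial elements cyclically; an
involution commuting with this action acts trivially, and none can invert it. This leads to a
central involution `z` in a normal subgroup `V` of order 16 (`hasCentralInvolution`). The action of
`b` on `V/⟨z⟩` then has the 𝔽₈ form, and the relation lifts to `V` after adjusting by `z` and
possibly inverting `b` (`Setting.exists_rel`, `rel_of_mul_conj`).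

Generators. Since `S` generates `G`, it contains some `a` outside `V`, which is `z ^ e * b` with `b`
of order 7, and some `t` not commuting with `b`. In suitable coordinates `t = x * z ^ f * b ^ j`. If
`e` or `f` is 1, a word in `a` and `t` depending only on `(e, f, j)` traces a Hamiltonian cycle. If
both vanish, `a` and `t` lie in a subgroup of index 2, and an element of `S` outside it either is
`z`, used as a third letter, or takes the place of `a` or `t`. -/

namespace SimpleGraph

/-! ### Hamiltonian cycles from words in the connection set -/

/-- A bijection from `Fin n` whose cyclically consecutive values are adjacent yields a
Hamiltonian cycle. -/
theorem isHamiltonian_of_bijective_of_adj {V : Type*} [Fintype V] [DecidableEq V]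
    (Γ : SimpleGraph V) {n : ℕ} (f : Fin (n + 3) → V) (hf : Function.Bijective f)
    (hadj : ∀ i, Γ.Adj (f i) (f (i + 1))) : Γ.IsHamiltonian := by
  intro _
  let φ : cycleGraph (n + 3) →g Γ :=
    { toFun := f
      map_rel' := by
        intro a b hab
        rcases (cycleGraph_adj (n := n + 1)).1 hab with h | h
        · rw [sub_eq_iff_eq_add] at h
          subst h
          rw [add_comm]
          exact (hadj b).symm
        · rw [sub_eq_iff_eq_add] at h
          subst h
          rw [add_comm]
          exact hadj a }
  refine ⟨φ 0, (cycleGraph.cycle n).map φ, ?_⟩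
  apply Walk.IsHamiltonianCycle.map (f := φ) hf
  rw [Walk.isHamiltonianCycle_iff_isCycle_and_length_eq]
  refine ⟨?_, by simp [cycleGraph.length_cycle]⟩
  exact cycleGraph.isCycle_cycle

/-- A word in the connection set whose value is trivial and whose prefixes represent every
element of the group yields a Hamiltonian cycle in the Cayley graph. -/
theorem mulCayley_isHamiltonian_of_word {G : Type*} [Group G] [Fintype G] [DecidableEq G]
    (S : Set G) (w : List G) (hlen : w.length = Fintype.card G) (hcard : 3 ≤ Fintype.card G)
    (hmem : ∀ g ∈ w, g ∈ S ∨ g⁻¹ ∈ S) (hprod : w.prod = 1)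
    (hcover : ∀ g : G, ∃ k < w.length, (w.take k).prod = g) :
    (mulCayley S).IsHamiltonian := by
  obtain ⟨n, hn⟩ : ∃ n, w.length = n + 3 := ⟨w.length - 3, by omega⟩
  let f : Fin (n + 3) → G := fun i => (w.take i).prod
  have hsurj : Function.Surjective f := by
    intro g
    obtain ⟨k, hk, rfl⟩ := hcover g
    exact ⟨⟨k, by omega⟩, rfl⟩
  have hbij : Function.Bijective f :=
    (Fintype.bijective_iff_surjective_and_card f).2 ⟨hsurj, by simp; omega⟩
  refine isHamiltonian_of_bijective_of_adj _ f hbij fun i => ?_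
  have hstep : f (i + 1) = f i * w[(i : ℕ)]'(by omega) := by
    have h1 : (w.take (i + 1 : ℕ)).prod = f i * w[(i : ℕ)]'(by omega) := by
      rw [List.prod_take_succ]
    rw [← h1]
    simp only [f]
    rw [Fin.val_add_one]
    -- At the last index `i + 1` wraps around to 0, and the cycle closes because the whole word has
    -- product 1.
    split_ifs with h
    · subst h
      simp only [List.take_zero, List.prod_nil, Fin.val_last]
      rw [List.take_of_length_le (by omega), hprod]
    · rfl
  rw [mulCayley_adj]
  refine ⟨fun h => ?_, ?_⟩
  · have := hbij.1 h
    simp at this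
  · rw [hstep]
    simpa using hmem _ (List.getElem_mem (show (i : ℕ) < w.length by omega))

end SimpleGraph

/-! ### The model group and its table of Hamiltonian words -/

namespace SylowSevenNonnormal

/-- Coordinates of `𝔽₈ × 𝔽₂`: the first three with respect to the basis `1, α, α²` of `𝔽₈`, where
`α³ = 1 + α`. -/
abbrev Vec := Bool × Bool × Bool × Bool

/-- Multiplication by `α` on the `𝔽₈`-component. -/
def Vec.rot : Vec → Vec
  | (p, q, r, s) => (r, p ^^ r, q, s)

/-- Addition in `𝔽₈ × 𝔽₂`. -/
def Vec.add : Vec → Vec → Vec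
  | (p, q, r, s), (p', q', r', s') => (p ^^ p', q ^^ q', r ^^ r', s ^^ s')

/-- The underlying set of `(𝔽₈ × 𝔽₂) ⋊ ⟨α⟩`. -/
abbrev Model := Vec × Fin 7

/-- Multiplication in `(𝔽₈ × 𝔽₂) ⋊ ⟨α⟩`. -/
def Model.mul : Model → Model → Model
  | (u, i), (v, j) => (u.add (Vec.rot^[i] v), i + j)

/-- The identity of `(𝔽₈ × 𝔽₂) ⋊ ⟨α⟩`. -/
def Model.one : Model := ((false, false, false, false), 0)

/-- The inverse in `(𝔽₈ × 𝔽₂) ⋊ ⟨α⟩`. -/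
def Model.inv : Model → Model
  | (v, i) => (Vec.rot^[(-i : Fin 7)] v, -i)

/-- A numbering of the elements of `Model`. -/
def Model.code : Model → ℕ
  | ((p, q, r, s), i) => p.toNat + 2 * q.toNat + 4 * r.toNat + 8 * s.toNat + 16 * i

/-- The inverse of `Model.code`. -/
def Model.ofCode (n : ℕ) : Model :=
  ((n.testBit 0, n.testBit 1, n.testBit 2, n.testBit 3), Fin.ofNat 7 (n / 16))

theorem Model.ofCode_code : ∀ m : Model, Model.ofCode m.code = m := by decide +kernel

theorem Model.code_lt : ∀ m : Model, m.code < 112 := by decide +kernel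

/-- The set of codes of the partial products of `w`, starting at `m`, as a bit mask. -/
def visited : Model → List Model → ℕ
  | _, [] => 0
  | m, a :: w => 2 ^ m.code ||| visited (m.mul a) w

/-- The letters of the words below: the two generators, their inverses, and the involution in
the center. -/
def letter (e f : Bool) (j : Fin 7) : ℕ → Model
  | 0 => ((false, false, false, e), 1)
  | 1 => Model.inv ((false, false, false, e), 1)
  | 2 => ((true, false, false, f), j)
  | 3 => Model.inv ((true, false, false, f), j)
  | _ => ((false, false, false, true), 0)

/-- A word whose given power traces a Hamiltonian cycle. -/
def cycleWord : Bool → Bool → Fin 7 → ℕ × List ℕ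
  | false, false, 0 => (7, [2, 0, 0, 0, 0, 0, 0, 4, 1, 1, 1, 2, 1, 1, 2, 4])
  | false, false, 1 => (7, [2, 0, 0, 0, 0, 0, 0, 4, 1, 2, 1, 1, 1, 1, 3, 4])
  | false, false, 2 => (7, [2, 0, 0, 0, 0, 0, 0, 4, 0, 0, 0, 0, 0, 0, 2, 4])
  | false, false, 3 => (7, [2, 0, 0, 0, 0, 0, 0, 4, 1, 1, 1, 1, 2, 1, 3, 4])
  | false, false, 4 => (7, [2, 0, 0, 0, 0, 0, 0, 4, 0, 0, 0, 2, 0, 2, 2, 4])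
  | false, false, 5 => (7, [2, 0, 0, 0, 0, 0, 0, 4, 0, 0, 2, 0, 3, 1, 2, 4])
  | false, false, 6 => (7, [2, 0, 0, 0, 0, 0, 0, 4, 1, 3, 0, 0, 3, 0, 2, 4])
  | false, true, 0 => (2, [0, 0, 0, 0, 0, 0, 2, 0, 0, 0, 0, 0, 0, 2, 0, 0, 0, 0, 0, 0, 2, 0, 0, 0, 0, 0, 0, 2,
      1, 1, 1, 1, 2, 1, 2, 0, 0, 0, 0, 0, 0, 2, 1, 1, 1, 1, 1, 1, 2, 1, 2, 1, 1, 1, 1, 2])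
  | false, true, 1 => (14, [2, 0, 0, 0, 0, 3, 0, 2])
  | false, true, 2 => (14, [2, 1, 3, 3, 3, 0, 0, 2])
  | false, true, 3 => (14, [2, 0, 0, 0, 3, 1, 1, 2])
  | false, true, 4 => (14, [2, 0, 0, 3, 1, 1, 1, 2])
  | false, true, 5 => (14, [2, 1, 1, 3, 3, 3, 0, 2])
  | false, true, 6 => (14, [2, 1, 3, 1, 1, 1, 1, 2])
  | true, false, 0 => (7, [0, 2, 0, 0, 2, 0, 2, 1, 2, 0, 2, 0, 0, 0, 0, 2])
  | true, false, 1 => (14, [2, 0, 0, 0, 0, 3, 0, 2])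
  | true, false, 2 => (14, [2, 1, 3, 3, 3, 0, 0, 2])
  | true, false, 3 => (14, [2, 0, 0, 0, 3, 1, 1, 2])
  | true, false, 4 => (14, [2, 0, 0, 3, 1, 1, 1, 2])
  | true, false, 5 => (14, [2, 1, 1, 3, 3, 3, 0, 2])
  | true, false, 6 => (14, [2, 1, 3, 1, 1, 1, 1, 2])
  | true, true, 0 => (7, [0, 2, 0, 0, 0, 0, 2, 1, 1, 1, 1, 1, 2, 0, 0, 2])
  | true, true, 1 => (7, [0, 2, 0, 0, 0, 0, 0, 0, 0, 0, 0, 0, 0, 0, 0, 2])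
  | true, true, 2 => (7, [0, 2, 0, 0, 2, 1, 1, 1, 1, 1, 3, 0, 0, 0, 0, 3])
  | true, true, 3 => (7, [0, 2, 0, 0, 0, 0, 0, 0, 0, 0, 0, 0, 3, 1, 1, 2])
  | true, true, 4 => (7, [0, 2, 0, 0, 3, 1, 1, 1, 1, 1, 1, 1, 1, 1, 1, 2])
  | true, true, 5 => (7, [0, 2, 0, 0, 0, 0, 0, 0, 2, 1, 1, 1, 1, 1, 1, 3])
  | true, true, 6 => (7, [0, 2, 0, 0, 0, 2, 0, 0, 0, 2, 0, 3, 0, 0, 0, 3])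

/-- The list of steps of a Hamiltonian cycle. -/
def cycleSteps (e f : Bool) (j : Fin 7) : List ℕ :=
  (List.replicate (cycleWord e f j).1 (cycleWord e f j).2).flatten

/-- The conditions on `cycleSteps` that make it a Hamiltonian cycle. -/
def IsCycleWord (e f : Bool) (j : Fin 7) : Bool :=
  let w := (cycleSteps e f j).map (letter e f j)
  -- Code 0 is the identity, and the mask `2 ^ 112 - 1` says that every code is visited. The letter
  -- 4, standing for `z`, is allowed only for `e = f = false`, when the two generators alone do not
  -- generate.
  w.length == 112 && (w.foldl Model.mul Model.one).code == 0 &&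
    visited Model.one w == 2 ^ 112 - 1 && (e == f && f == false || (cycleSteps e f j).all (· < 4))

theorem isCycleWord_true : ∀ e f j, IsCycleWord e f j = true := by decide +kernel

/-- Relations under which `b`, `x`, `z` generate a quotient of `(𝔽₈ × 𝔽₂) ⋊ ⟨α⟩`. -/
structure Rel {G : Type*} [Group G] (b x z : G) : Prop where
  b_pow : b ^ 7 = 1
  z_sq : z * z = 1
  z_comm : ∀ g, Commute z g
  x_sq : x * x = 1
  comm_one : Commute x (b * x * b⁻¹)
  comm_two : Commute x (b ^ 2 * x * (b ^ 2)⁻¹)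
  rel : b ^ 3 * x * (b ^ 3)⁻¹ = x * (b * x * b⁻¹)

/-! ### Evaluating model coordinates in a group satisfying the relations -/

section enc

variable {G : Type*} [Group G]

/-- The element `x ^ p` for `p` a truth value. -/
def bpow (x : G) (p : Bool) : G := cond p x 1

/-- The element of `G` with given `Vec`-coordinates. -/
def encVec (b x z : G) : Vec → G
  | (p, q, r, s) =>
    bpow x p * bpow (b * x * b⁻¹) q * bpow (b ^ 2 * x * (b ^ 2)⁻¹) r * bpow z s

/-- The evaluation of the coordinates `Model` in `G`. -/
def enc (b x z : G) : Model → G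
  | (v, i) => encVec b x z v * b ^ (i : ℕ)

theorem bpow_xor {x : G} (hx : x * x = 1) (p q : Bool) :
    bpow x (p ^^ q) = bpow x p * bpow x q := by
  cases p <;> cases q <;> simp [bpow, hx]

theorem commute_bpow {x y : G} (h : Commute x y) (p q : Bool) :
    Commute (bpow x p) (bpow y q) := by
  cases p <;> cases q <;> simp [bpow, h]

theorem conj_bpow (b x : G) (p : Bool) : b * bpow x p * b⁻¹ = bpow (b * x * b⁻¹) p := by
  cases p <;> simp [bpow]

variable {b x z : G}

theorem conj_mul_self_eq_one (hx : x * x = 1) (c : G) :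
    (c * x * c⁻¹) * (c * x * c⁻¹) = 1 := by
  have : (c * x * c⁻¹) * (c * x * c⁻¹) = c * (x * x) * c⁻¹ := by group
  rw [this, hx]; group

theorem Rel.comm_one_two (h : Rel b x z) :
    Commute (b * x * b⁻¹) (b ^ 2 * x * (b ^ 2)⁻¹) := by
  have := h.comm_one.map (MulAut.conj b)
  simp only [MulAut.conj_apply] at this
  convert this using 1
  rw [pow_two]; group

theorem encVec_add (h : Rel b x z) (u v : Vec) :
    encVec b x z (u.add v) = encVec b x z u * encVec b x z v := by
  obtain ⟨p, q, r, s⟩ := u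
  obtain ⟨p', q', r', s'⟩ := v
  simp only [encVec, Vec.add, bpow_xor h.x_sq, bpow_xor (conj_mul_self_eq_one h.x_sq _),
    bpow_xor h.z_sq]
  generalize hy : b * x * b⁻¹ = y
  generalize hw : b ^ 2 * x * (b ^ 2)⁻¹ = w
  have hxy : Commute (bpow x p') (bpow y q) := commute_bpow (hy ▸ h.comm_one) _ _
  have hxw : Commute (bpow x p') (bpow w r) := commute_bpow (hw ▸ h.comm_two) _ _
  have hyw : Commute (bpow y q') (bpow w r) := commute_bpow (hy ▸ hw ▸ h.comm_one_two) _ _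
  have hz : ∀ g, Commute (bpow z s) g := fun g => by
    cases s
    · simp [bpow]
    · exact h.z_comm g
  calc _ = bpow x p * (bpow x p' * bpow y q) * bpow y q' * bpow w r * bpow w r' *
        bpow z s * bpow z s' := by simp only [mul_assoc]
    _ = bpow x p * bpow y q * bpow x p' * (bpow y q' * bpow w r) * bpow w r' *
        bpow z s * bpow z s' := by rw [hxy.eq]; simp only [mul_assoc]
    _ = bpow x p * bpow y q * (bpow x p' * bpow w r) * bpow y q' * bpow w r' *
        bpow z s * bpow z s' := by rw [hyw.eq]; simp only [mul_assoc]
    _ = bpow x p * bpow y q * bpow w r * (bpow x p' * bpow y q' * bpow w r' * bpow z s) *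
        bpow z s' := by rw [hxw.eq]; simp only [mul_assoc]
    _ = _ := by rw [← (hz (bpow x p' * bpow y q' * bpow w r')).eq]; simp only [mul_assoc]

/-- Conjugation by `b` shifts `x`, `bxb⁻¹`, `b²xb⁻²` cyclically except for the last, where `Rel.rel`
plays the role of `α³ = 1 + α`. -/
theorem encVec_rot (h : Rel b x z) (v : Vec) :
    encVec b x z v.rot = b * encVec b x z v * b⁻¹ := by
  obtain ⟨p, q, r, s⟩ := v
  have key : b * encVec b x z (p, q, r, s) * b⁻¹ = (b * bpow x p * b⁻¹) *
      (b * bpow (b * x * b⁻¹) q * b⁻¹) * (b * bpow (b ^ 2 * x * (b ^ 2)⁻¹) r * b⁻¹) *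
      (b * bpow z s * b⁻¹) := by
    simp only [encVec]; group
  have h1 : b * (b * x * b⁻¹) * b⁻¹ = b ^ 2 * x * (b ^ 2)⁻¹ := by rw [pow_two]; group
  have h2 : b * (b ^ 2 * x * (b ^ 2)⁻¹) * b⁻¹ = x * (b * x * b⁻¹) := by
    rw [← h.rel]; group
  have h3 : b * z * b⁻¹ = z := by rw [← (h.z_comm b).eq]; group
  rw [key, conj_bpow, conj_bpow, conj_bpow, conj_bpow, h1, h2, h3]
  simp only [encVec, Vec.rot, bpow_xor (conj_mul_self_eq_one h.x_sq _)]
  generalize hy : b * x * b⁻¹ = y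
  generalize hw : b ^ 2 * x * (b ^ 2)⁻¹ = w
  have hxy : Commute x y := hy ▸ h.comm_one
  have hxw : Commute x w := hw ▸ h.comm_two
  have hyw : Commute y w := hy ▸ hw ▸ h.comm_one_two
  have hr : bpow (x * y) r = bpow x r * bpow y r := by cases r <;> simp [bpow]
  have e1 : Commute (bpow w q) (bpow x r) := (commute_bpow hxw r q).symm
  have e2 : Commute (bpow w q) (bpow y r) := (commute_bpow hyw r q).symm
  have e3 : Commute (bpow x r) (bpow y p) := commute_bpow hxy _ _
  rw [hr]
  calc _ = bpow x r * bpow y p * (bpow y r * bpow w q) * bpow z s := by simp only [mul_assoc]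
    _ = bpow y p * (bpow x r * bpow w q) * bpow y r * bpow z s := by
      rw [e3.eq, ← e2.eq]; simp only [mul_assoc]
    _ = _ := by rw [← e1.eq]; simp only [mul_assoc]

theorem encVec_rot_iterate (h : Rel b x z) (n : ℕ) (v : Vec) :
    encVec b x z (Vec.rot^[n] v) = b ^ n * encVec b x z v * (b ^ n)⁻¹ := by
  induction n with
  | zero => simp
  | succ n ih =>
    rw [Function.iterate_succ_apply', encVec_rot h, ih, pow_succ']
    group

theorem pow_fin_add (hb : b ^ 7 = 1) (i j : Fin 7) :
    b ^ ((i + j : Fin 7) : ℕ) = b ^ (i : ℕ) * b ^ (j : ℕ) := by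
  rw [← pow_add, Fin.val_add, ← pow_eq_pow_mod _ hb]

theorem enc_mul (h : Rel b x z) (m n : Model) :
    enc b x z (m.mul n) = enc b x z m * enc b x z n := by
  obtain ⟨u, i⟩ := m
  obtain ⟨v, j⟩ := n
  simp only [enc, Model.mul, encVec_add h, encVec_rot_iterate h, pow_fin_add h.b_pow]
  group

theorem enc_one : enc b x z Model.one = 1 := by
  simp [enc, encVec, Model.one, bpow]

theorem enc_inv (h : Rel b x z) (m : Model) : enc b x z m.inv = (enc b x z m)⁻¹ := by
  have : ∀ m : Model, m.mul m.inv = Model.one := by decide +kernel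
  rw [← mul_eq_one_iff_eq_inv', ← enc_mul h, this, enc_one]

end enc

theorem exists_take_of_testBit_visited (w : List Model) (m : Model) (c : ℕ)
    (hc : (visited m w).testBit c = true) :
    ∃ k < w.length, ((w.take k).foldl Model.mul m).code = c := by
  induction w generalizing m with
  | nil => simp [visited] at hc
  | cons a w ih =>
    rw [visited, Nat.testBit_or, Bool.or_eq_true, Nat.testBit_two_pow] at hc
    rcases hc with hc | hc
    · exact ⟨0, by simp, by simpa using hc⟩
    · obtain ⟨k, hk, hk'⟩ := ih _ hc
      exact ⟨k + 1, by simpa using hk, by simpa using hk'⟩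

theorem enc_foldl {G : Type*} [Group G] {b x z : G} (h : Rel b x z) (w : List Model) (m : Model) :
    enc b x z (w.foldl Model.mul m) = enc b x z m * (w.map (enc b x z)).prod := by
  induction w generalizing m with
  | nil => simp
  | cons a w ih => simp [ih, enc_mul h, mul_assoc]

theorem mulCayley_isHamiltonian_of_rel {G : Type*} [Group G] [Fintype G] [DecidableEq G]
    (hG : Fintype.card G = 112) {b x z : G} (h : Rel b x z)
    (hsurj : Function.Surjective (enc b x z)) (S : Set G) (e f : Bool) (j : Fin 7)
    (ha : enc b x z ((false, false, false, e), 1) ∈ S ∪ S⁻¹)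
    (ht : enc b x z ((true, false, false, f), j) ∈ S ∪ S⁻¹)
    (hz : e = true ∨ f = true ∨ z ∈ S ∪ S⁻¹) :
    (SimpleGraph.mulCayley S).IsHamiltonian := by
  have hw := isCycleWord_true e f j
  simp only [IsCycleWord, Bool.and_eq_true, beq_iff_eq, Bool.or_eq_true, List.all_eq_true,
    decide_eq_true_eq] at hw
  obtain ⟨⟨⟨hlen, hprod⟩, hcover⟩, hlet⟩ := hw
  set w := (cycleSteps e f j).map (letter e f j) with hwdef
  have hsymm : ∀ g : G, g ∈ S ∪ S⁻¹ → g⁻¹ ∈ S ∪ S⁻¹ := by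
    rintro g (hg | hg)
    · exact Or.inr (by simpa using hg)
    · exact Or.inl hg
  refine SimpleGraph.mulCayley_isHamiltonian_of_word S (w.map (enc b x z)) ?_ ?_ ?_ ?_ ?_
  · rw [List.length_map, hlen, hG]
  · omega
  · suffices ∀ g ∈ w.map (enc b x z), g ∈ S ∪ S⁻¹ from this
    intro g hg
    simp only [hwdef, List.map_map, List.mem_map, Function.comp_apply] at hg
    obtain ⟨n, hn, rfl⟩ := hg
    match n with
    | 0 => exact ha
    | 1 => rw [letter, enc_inv h]; exact hsymm _ ha
    | 2 => exact ht
    | 3 => rw [letter, enc_inv h]; exact hsymm _ ht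
    | n + 4 =>
      have hz' : z ∈ S ∪ S⁻¹ := by
        rcases hz with rfl | rfl | hz
        · rcases hlet with ⟨h1, h2⟩ | hlet
          · simp_all
          · have := hlet _ hn; omega
        · rcases hlet with ⟨h1, h2⟩ | hlet
          · simp_all
          · have := hlet _ hn; omega
        · exact hz
      simpa [letter, enc, encVec, bpow] using hz'
  · have := enc_foldl h w Model.one
    rw [enc_one, one_mul] at this
    rw [← this, ← Model.ofCode_code (List.foldl _ _ _), hprod, ← enc_one (b := b) (x := x) (z := z)]
    congr 1
  · intro g
    obtain ⟨m, rfl⟩ := hsurj g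
    obtain ⟨k, hk, hk'⟩ := exists_take_of_testBit_visited w Model.one m.code (by
      rw [hcover, Nat.testBit_two_pow_sub_one]
      simpa using m.code_lt)
    refine ⟨k, by simpa using hk, ?_⟩
    have := enc_foldl h (w.take k) Model.one
    rw [enc_one, one_mul] at this
    rw [← List.map_take, ← this, ← Model.ofCode_code (List.foldl _ _ _), hk', Model.ofCode_code]

/-! ### Fixed-point-free automorphisms of order 7 on a group of order 8 -/

section orbit

variable {G : Type*} [Group G]

theorem apply_eq_self_of_pow_apply {φ : MulAut G} (hφ : φ ^ 7 = 1) {n : ℕ} (hn : ¬ 7 ∣ n) {y : G}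
    (h : (φ ^ n) y = y) : φ y = y := by
  obtain ⟨m, -, hm⟩ := Nat.exists_mul_mod_eq_one_of_coprime
    ((Nat.Prime.coprime_iff_not_dvd (by norm_num)).2 hn).symm (by norm_num : 1 < 7)
  have h1 : φ = (φ ^ n) ^ m := by
    rw [← pow_mul, pow_eq_pow_mod _ hφ, hm, pow_one]
  have h2 : ∀ k : ℕ, ((φ ^ n) ^ k) y = y := by
    intro k
    induction k with
    | zero => simp
    | succ k ih => rw [pow_succ, MulAut.mul_apply, h, ih]
  rw [h1, h2]

theorem pow_add_apply (φ : MulAut G) (i j : ℕ) (y : G) : (φ ^ i) ((φ ^ j) y) = (φ ^ (i + j)) y := by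
  rw [pow_add, MulAut.mul_apply]

/-- An automorphism of order dividing `7` acting without nontrivial fixed points on a subgroup of
order `8`. -/
structure FixedPointFree (φ : MulAut G) (E : Subgroup G) : Prop where
  card : Nat.card E = 8
  pow_seven : φ ^ 7 = 1
  map_mem : ∀ e ∈ E, φ e ∈ E
  eq_one : ∀ e ∈ E, φ e = e → e = 1

variable {φ : MulAut G} {E : Subgroup G}

theorem FixedPointFree.pow_map_mem (h : FixedPointFree φ E) (i : ℕ) {e : G} (he : e ∈ E) :
    (φ ^ i) e ∈ E := by
  induction i with
  | zero => simpa
  | succ i ih => rw [pow_succ', MulAut.mul_apply]; exact h.map_mem _ ih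

theorem FixedPointFree.pow_mod (h : FixedPointFree φ E) (i : ℕ) (y : G) :
    (φ ^ i) y = (φ ^ (i % 7)) y := by
  rw [pow_eq_pow_mod _ h.pow_seven]

theorem FixedPointFree.mod_eq (h : FixedPointFree φ E) {y : G} (hy : y ∈ E) (hy1 : y ≠ 1)
    {i j : ℕ} (hij : (φ ^ i) y = (φ ^ j) y) : i % 7 = j % 7 := by
  wlog hle : i ≤ j generalizing i j
  · exact (this hij.symm (by omega)).symm
  by_contra hne
  have h1 : (φ ^ (j - i)) y = y := by
    apply (φ ^ i).injective
    rw [pow_add_apply, Nat.add_sub_cancel' hle, hij]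
  exact hy1 (h.eq_one y hy (apply_eq_self_of_pow_apply h.pow_seven (by omega) h1))

/-- The seven images of `y` are distinct and differ from 1, so together with 1 they exhaust the
eight elements of `E`. -/
theorem FixedPointFree.exists_pow_apply (h : FixedPointFree φ E) {y : G} (hy : y ∈ E) (hy1 : y ≠ 1)
    {e : G} (he : e ∈ E) (he1 : e ≠ 1) : ∃ i < 7, e = (φ ^ i) y := by
  let f : Option (Fin 7) → E := fun o => o.elim 1 fun i => ⟨(φ ^ (i : ℕ)) y, h.pow_map_mem _ hy⟩
  have hinj : Function.Injective f := by
    have hne : ∀ i : ℕ, (φ ^ i) y ≠ 1 := fun i hi => hy1 ((φ ^ i).injective (by simpa using hi))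
    rintro (_ | i) (_ | j) hij
    · rfl
    · exact absurd (congrArg Subtype.val hij).symm (hne j)
    · exact absurd (congrArg Subtype.val hij) (hne i)
    · have := h.mod_eq hy hy1 (congrArg Subtype.val hij)
      congr 1
      ext
      omega
  have : Finite E := Nat.finite_of_card_ne_zero (by rw [h.card]; norm_num)
  have hbij : Function.Bijective f :=
    (Nat.bijective_iff_injective_and_card f).2 ⟨hinj, by simp [h.card]⟩
  obtain ⟨o, ho⟩ := hbij.2 ⟨e, he⟩
  rcases o with _ | i
  · exact absurd (congrArg Subtype.val ho).symm he1
  · exact ⟨i, i.2, (congrArg Subtype.val ho).symm⟩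

/-- Cauchy gives one involution, and its `φ`-orbit contains every nontrivial element. -/
theorem FixedPointFree.mul_self (h : FixedPointFree φ E) {y : G} (hy : y ∈ E) : y * y = 1 := by
  have : Finite E := Nat.finite_of_card_ne_zero (by rw [h.card]; norm_num)
  have : Fact (Nat.Prime 2) := ⟨Nat.prime_two⟩
  obtain ⟨⟨t, ht⟩, hto⟩ := exists_prime_orderOf_dvd_card' (G := E) 2 (by rw [h.card]; norm_num)
  rw [Subgroup.orderOf_mk, orderOf_eq_prime_iff] at hto
  by_cases hy1 : y = 1
  · simp [hy1]
  obtain ⟨i, -, rfl⟩ := h.exists_pow_apply ht hto.2 hy hy1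
  rw [← map_mul, ← pow_two, hto.1, map_one]

theorem mul_comm_of_mul_self {x y : G} (hx : x * x = 1) (hy : y * y = 1)
    (hxy : x * y * (x * y) = 1) : x * y = y * x := by
  rw [eq_inv_of_mul_eq_one_left hxy, mul_inv_rev, ← eq_inv_of_mul_eq_one_left hx,
    ← eq_inv_of_mul_eq_one_left hy]

theorem FixedPointFree.mul_comm (h : FixedPointFree φ E) {x y : G} (hx : x ∈ E) (hy : y ∈ E) :
    x * y = y * x :=
  mul_comm_of_mul_self (h.mul_self hx) (h.mul_self hy) (h.mul_self (mul_mem hx hy))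

theorem FixedPointFree.pow_mul (h : FixedPointFree φ E) {y : G} {k : ℕ}
    (hk : y * φ y = (φ ^ k) y) (i : ℕ) : (φ ^ i) y * (φ ^ (i + 1)) y = (φ ^ ((i + k) % 7)) y := by
  rw [← h.pow_mod, ← pow_add_apply, ← pow_add_apply, ← hk, map_mul, pow_one]

/-- Writing `yᵢ = φⁱ y`, a relation `y₀y₁ = y_k` shifts to `yᵢyᵢ₊₁ = yᵢ₊ₖ`. For `k = 2, 4, 6`,
combining two shifts identifies two distinct `yᵢ`. The surviving values correspond to the two
irreducible cubics over 𝔽₂. -/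
theorem FixedPointFree.mul_apply (h : FixedPointFree φ E) {y : G} (hy : y ∈ E) (hy1 : y ≠ 1) :
    y * φ y = (φ ^ 3) y ∨ y * φ y = (φ ^ 5) y := by
  have hne : y * φ y ≠ 1 := by
    intro h1
    have h2 : φ y = y := by
      rw [← h.mul_self hy] at h1
      exact mul_left_cancel h1
    exact hy1 (h.eq_one y hy h2)
  obtain ⟨k, hk7, hk⟩ := h.exists_pow_apply hy hy1 (mul_mem hy (h.map_mem y hy)) hne
  have hk' := h.pow_mul hk
  have hmod : ∀ {i j : ℕ}, (φ ^ i) y = (φ ^ j) y → i % 7 = j % 7 := fun hij => h.mod_eq hy hy1 hij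
  interval_cases k
  · exfalso
    have : φ y = 1 := by simpa using hk
    exact hy1 (by simpa using this)
  · exfalso
    exact hy1 (by simpa using hk)
  · exfalso
    have h1 := hk' 0
    have h2 := hk' 1
    norm_num only at h1 h2
    rw [← h1, h.mul_comm (h.pow_map_mem 0 hy) (h.pow_map_mem 1 hy), ← mul_assoc,
      h.mul_self (h.pow_map_mem 1 hy), one_mul] at h2
    exact absurd (hmod h2) (by norm_num)
  · exact Or.inl hk
  · exfalso
    have h1 := hk' 0
    have h2 := hk' 3
    norm_num only at h1 h2
    rw [← h1, ← mul_assoc, h.mul_comm (h.pow_map_mem 3 hy) (h.pow_map_mem 0 hy), mul_assoc,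
      mul_eq_left, ← h.mul_self (h.pow_map_mem 1 hy), mul_left_inj] at h2
    exact absurd (hmod h2) (by norm_num)
  · exact Or.inr hk
  · exfalso
    have h1 := hk' 0
    have h2 := hk' 6
    norm_num only at h1 h2
    have h3 : (φ ^ 7) y = (φ ^ 0) y := by rw [h.pow_seven, pow_zero]
    rw [h3, ← h1, h.mul_comm (h.pow_map_mem 0 hy) (h.pow_map_mem 1 hy), mul_assoc,
      h.mul_self (h.pow_map_mem 0 hy), mul_one] at h2
    exact absurd (hmod h2) (by norm_num)

/-- If `ψ e = φⁱ e`, then `ψ² = 1` gives `φ²ⁱ e = e`, so 7 divides `i`. -/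
theorem FixedPointFree.apply_eq_self_of_commute (h : FixedPointFree φ E) {ψ : MulAut G}
    (hψ : ψ * ψ = 1) (hmem : ∀ e ∈ E, ψ e ∈ E) (hc : ψ * φ = φ * ψ) {e : G} (he : e ∈ E) :
    ψ e = e := by
  by_cases he1 : e = 1
  · simp [he1]
  obtain ⟨i, hi, hi'⟩ := h.exists_pow_apply he he1 (hmem e he) (by simpa using he1)
  have h1 : ψ (ψ e) = e := by rw [← MulAut.mul_apply, hψ, MulAut.one_apply]
  have h2 : ψ * φ ^ i = φ ^ i * ψ := (show Commute ψ φ from hc).pow_right i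
  have h3 : (φ ^ (i + i)) e = (φ ^ 0) e := by
    rw [← pow_add_apply, ← hi', ← MulAut.mul_apply, ← h2, MulAut.mul_apply, ← hi', h1]
    simp
  have h4 := h.mod_eq he he1 h3
  obtain rfl : i = 0 := by omega
  simpa using hi'

/-- An inverting `ψ` would fix some nontrivial `y`. Comparing `ψ` and `φ⁻¹` applied to `y * φ y = φᵏ
y` gives `-k ≡ k - 1` mod 7, so `k = 4`, contrary to `FixedPointFree.mul_apply`. -/
theorem FixedPointFree.not_inverted (h : FixedPointFree φ E) {ψ : MulAut G}
    (hmem : ∀ e ∈ E, ψ e ∈ E) (hc : ψ * φ = φ ^ 6 * ψ) : False := by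
  have : Finite E := Nat.finite_of_card_ne_zero (by rw [h.card]; norm_num)
  have hnt : Nontrivial E := Finite.one_lt_card_iff_nontrivial.1 (by rw [h.card]; norm_num)
  obtain ⟨⟨e, he⟩, hne⟩ := exists_ne (1 : E)
  have he1 : e ≠ 1 := fun h => hne (Subtype.ext h)
  obtain ⟨c, hc7, hc'⟩ := h.exists_pow_apply he he1 (hmem e he) (by simpa using he1)
  have hpow : ∀ i : ℕ, ψ * φ ^ i = φ ^ (6 * i) * ψ := by
    intro i
    induction i with
    | zero => simp
    | succ i ih => rw [pow_succ, ← mul_assoc, ih, mul_assoc, hc, ← mul_assoc, ← pow_add, mul_add_one]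
  have hpow' : ∀ (i : ℕ) (g : G), ψ ((φ ^ i) g) = (φ ^ (6 * i)) (ψ g) := fun i g => by
    rw [← MulAut.mul_apply, hpow, MulAut.mul_apply]
  -- For `φᵐ e` to be fixed by `ψ` one needs `-m + c ≡ m` mod 7; 4 is the inverse of 2.
  obtain ⟨y, hy⟩ : ∃ y, y = (φ ^ (4 * c)) e := ⟨_, rfl⟩
  have hyE : y ∈ E := hy ▸ h.pow_map_mem _ he
  have hy1 : y ≠ 1 := fun h1 => he1 ((φ ^ (4 * c)).injective (by rw [← hy, h1, map_one]))
  have hψy : ψ y = y := by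
    rw [hy, hpow', hc', pow_add_apply, h.pow_mod (6 * (4 * c) + c), h.pow_mod (4 * c),
      show (6 * (4 * c) + c) % 7 = 4 * c % 7 by omega]
  have hmod : ∀ {i j : ℕ}, (φ ^ i) y = (φ ^ j) y → i % 7 = j % 7 := fun hij => h.mod_eq hyE hy1 hij
  have key : ∀ k : ℕ, y * φ y = (φ ^ k) y → (6 * k) % 7 = (6 + k) % 7 := by
    intro k hk
    have h1 := congrArg ψ hk
    rw [map_mul, hpow', hψy, ← MulAut.mul_apply, hc, MulAut.mul_apply, hψy] at h1
    have h2 := congrArg (⇑(φ ^ 6)) hk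
    rw [map_mul, pow_add_apply, ← MulAut.mul_apply, ← pow_succ, h.pow_seven, MulAut.one_apply,
      h.mul_comm (h.pow_map_mem 6 hyE) hyE] at h2
    apply hmod
    rw [← h1, ← h2]
  rcases h.mul_apply hyE hy1 with hk | hk
  · exact absurd (key 3 hk) (by norm_num)
  · exact absurd (key 5 hk) (by norm_num)

end orbit

/-! ### Normalizers and centralizers of subgroups of order 7 -/

section

open Subgroup

variable {G : Type*} [Group G]

theorem conj_pow_seven {b : G} (hb : orderOf b = 7) : MulAut.conj b ^ 7 = 1 := by
  rw [← map_pow, ← hb, pow_orderOf_eq_one, map_one]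

variable [Finite G]

/-- Counting fixed points of conjugation by an element of order dividing `7`. -/
theorem card_modEq_card_inf_centralizer {b : G} (hb : b ^ 7 = 1) (A : Subgroup G) [A.Normal] :
    Nat.card A ≡ Nat.card (A ⊓ centralizer {b} : Subgroup G) [MOD 7] := by
  classical
  have : Fact (Nat.Prime 7) := ⟨by norm_num⟩
  have := Fintype.ofFinite A
  have hiter : ∀ (n : ℕ) (a : A), ((fun a => MulAut.conjNormal b a)^[n] a : A) =
      MulAut.conjNormal (b ^ n) a := by
    intro n a
    induction n with
    | zero => simp
    | succ n ih => rw [Function.iterate_succ_apply', ih, pow_succ', map_mul, MulAut.mul_apply]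
  let f : Function.End A := fun a => MulAut.conjNormal b a
  have hf : f ^ 7 ^ 1 = 1 := by
    funext a
    have h7 := hiter 7 a
    rw [hb] at h7
    have h8 : (f ^ 7 ^ 1 : Function.End A) a = (fun a => MulAut.conjNormal b a)^[7] a := rfl
    rw [h8, h7]
    simp only [map_one]
    rfl
  have := Equiv.Perm.card_fixedPoints_modEq hf
  rw [← Nat.card_eq_fintype_card, ← Nat.card_eq_fintype_card] at this
  let e : Function.fixedPoints f ≃ (A ⊓ centralizer {b} : Subgroup G) :=
    { toFun := fun a => ⟨a.1, a.1.2, by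
        have h := congrArg Subtype.val a.2
        exact mem_centralizer_singleton_iff.2 (mul_inv_eq_iff_eq_mul.1 h).symm⟩
      invFun := fun g => ⟨⟨g.1, g.2.1⟩, by
        have h := mem_centralizer_singleton_iff.1 g.2.2
        exact Subtype.ext (mul_inv_eq_iff_eq_mul.2 h.symm)⟩
      left_inv := fun _ => rfl
      right_inv := fun _ => rfl }
  rwa [Nat.card_congr e] at this

/-- In a group of order `112` with nonnormal Sylow `7`-subgroups, a subgroup of order `7` has
a normalizer of order `14`. -/
theorem card_normalizer_zpowers (hG : Nat.card G = 112)
    (hnormal : ∀ P : Sylow 7 G, ¬ (P : Subgroup G).Normal) {b : G} (hb : orderOf b = 7) :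
    Nat.card (normalizer (zpowers b : Set G)) = 14 := by
  have : Fact (Nat.Prime 7) := ⟨by norm_num⟩
  have hfac : (112 : ℕ).factorization 7 = 1 := by
    rw [show 112 = 7 ^ 1 * 16 by norm_num, Nat.factorization_mul (by norm_num) (by norm_num)]
    simp [Nat.Prime.factorization_self (show Nat.Prime 7 by norm_num),
      Nat.factorization_eq_zero_of_not_dvd (show ¬ 7 ∣ 16 by norm_num)]
  let P : Sylow 7 G := Sylow.ofCard (zpowers b) (by rw [Nat.card_zpowers, hb, hG, hfac, pow_one])
  have hP : (P : Subgroup G) = zpowers b := rfl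
  have h1 := P.card_eq_index_normalizer
  have h2 := card_sylow_modEq_one 7 G
  have h3 := P.card_dvd_index
  have h4 := (P : Subgroup G).card_mul_index
  have h5 := (normalizer (P : Set G)).card_mul_index
  have h6 := hnormal P
  have h7 : (normalizer (P : Set G)).index ≠ 1 := by
    rw [Ne, index_eq_one]
    exact fun h => h6 (normalizer_eq_top_iff.1 h)
  have h8 : Nat.card (P : Subgroup G) = 7 := by rw [hP, Nat.card_zpowers, hb]
  rw [h8, hG] at h4
  rw [hG, ← h1] at h5
  rw [← h1] at h7
  have h9 : (P : Subgroup G).index = 16 := by omega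
  rw [h9] at h3
  have h10 : Nat.card (Sylow 7 G) ≤ 16 := Nat.le_of_dvd (by norm_num) h3
  -- The number of Sylow subgroups divides 16, is 1 mod 7, and is not 1.
  have h11 : Nat.card (Sylow 7 G) = 8 := by
    generalize Nat.card (Sylow 7 G) = n at *
    unfold Nat.ModEq at h2
    interval_cases n <;> omega
  rw [h11] at h5
  have : Nat.card (normalizer (P : Set G)) = 14 := by omega
  exact this

theorem card_centralizer_dvd (hG : Nat.card G = 112)
    (hnormal : ∀ P : Sylow 7 G, ¬ (P : Subgroup G).Normal) {b : G} (hb : orderOf b = 7) :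
    Nat.card (centralizer {b} : Subgroup G) ∣ 14 := by
  rw [← card_normalizer_zpowers hG hnormal hb]
  apply card_dvd_of_le
  rw [← centralizer_closure, ← zpowers_eq_closure]
  exact centralizer_le_normalizer _

theorem fixedPointFree_conj (hG : Nat.card G = 112)
    (hnormal : ∀ P : Sylow 7 G, ¬ (P : Subgroup G).Normal) {b : G} (hb : orderOf b = 7)
    (D : Subgroup G) [hD : D.Normal] (hcard : Nat.card D = 8) :
    FixedPointFree (MulAut.conj b) D where
  card := hcard
  pow_seven := conj_pow_seven hb
  map_mem e he := hD.conj_mem e he b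
  eq_one e he h := by
    have h1 := card_modEq_card_inf_centralizer (hb ▸ pow_orderOf_eq_one b) D
    have h2 : Nat.card (D ⊓ centralizer {b} : Subgroup G) ∣ 14 :=
      (card_dvd_of_le inf_le_right).trans (card_centralizer_dvd hG hnormal hb)
    have h3 : Nat.card (D ⊓ centralizer {b} : Subgroup G) ∣ 8 :=
      hcard ▸ card_dvd_of_le inf_le_left
    have h4 : Nat.card (D ⊓ centralizer {b} : Subgroup G) ∣ 2 := Nat.dvd_gcd h2 h3
    -- The number of fixed points divides `gcd(14, 8) = 2` and is congruent to 8 mod 7.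
    have h5 : D ⊓ centralizer {b} = ⊥ := by
      rw [← card_eq_one]
      rcases (Nat.dvd_prime Nat.prime_two).1 h4 with h | h
      · exact h
      · rw [h, hcard] at h1
        exact absurd h1 (by decide)
    rw [← mem_bot (G := G), ← h5, mem_inf, mem_centralizer_singleton_iff]
    refine ⟨he, ?_⟩
    rw [MulAut.conj_apply, mul_inv_eq_iff_eq_mul] at h
    exact h.symm

/-- An involution normalizing a subgroup of order `7` centralizes or inverts it. -/
theorem exists_involution (hG : Nat.card G = 112)
    (hnormal : ∀ P : Sylow 7 G, ¬ (P : Subgroup G).Normal) {b : G} (hb : orderOf b = 7) :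
    ∃ t : G, t * t = 1 ∧ t ≠ 1 ∧ (t * b = b * t ∨ t * b = b ^ 6 * t) := by
  have : Fact (Nat.Prime 2) := ⟨Nat.prime_two⟩
  obtain ⟨⟨t, ht⟩, hto⟩ := exists_prime_orderOf_dvd_card'
    (G := normalizer (zpowers b : Set G)) 2
    (by rw [card_normalizer_zpowers hG hnormal hb]; norm_num)
  rw [orderOf_mk, orderOf_eq_prime_iff, pow_two] at hto
  refine ⟨t, hto.1, hto.2, ?_⟩
  have h1 : t * b * t⁻¹ ∈ zpowers b := ((mem_normalizer_iff.1 ht) b).1 (mem_zpowers b)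
  obtain ⟨m, hm, hm'⟩ : ∃ m < 7, b ^ m = t * b * t⁻¹ := by
    classical
    rw [← mem_powers_iff_mem_zpowers, mem_powers_iff_mem_range_orderOf, hb] at h1
    simpa using h1
  -- Conjugating twice by `t` is trivial, so `m² ≡ 1` mod 7 and `m` is 1 or 6.
  have h2 : b ^ (m * m) = b ^ 1 := by
    rw [pow_mul, hm', conj_pow, hm']
    have h3 : t⁻¹ = t := inv_eq_of_mul_eq_one_left hto.1
    rw [h3]
    calc t * (t * b * t) * t = (t * t) * b * (t * t) := by group
      _ = _ := by rw [hto.1]; simp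
  rw [pow_inj_mod, hb] at h2
  rw [eq_mul_inv_iff_mul_eq] at hm'
  interval_cases m
  all_goals first | omega | skip
  · left; rw [← hm', pow_one]
  · right; rw [← hm']

end

/-! ### Constructing a central involution -/

section

open Subgroup

variable {G : Type*} [Group G]

theorem orderOf_dvd_of_mem {H : Subgroup G} {g : G} (hg : g ∈ H) : orderOf g ∣ Nat.card H := by
  rw [← orderOf_mk g hg]
  exact orderOf_dvd_natCard _

variable [Finite G]

theorem exists_orderOf_eq_seven (hG : Nat.card G = 112) : ∃ b : G, orderOf b = 7 := by
  have : Fact (Nat.Prime 7) := ⟨by norm_num⟩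
  exact exists_prime_orderOf_dvd_card' 7 (by rw [hG]; norm_num)

/-- A central involution and a normal subgroup of order `16` containing it. -/
def HasCentralInvolution (G : Type*) [Group G] : Prop :=
  ∃ z : G, z * z = 1 ∧ z ≠ 1 ∧ (∀ g, Commute z g) ∧
    ∃ V : Subgroup G, V.Normal ∧ Nat.card V = 16 ∧ z ∈ V

theorem commute_of_le_centralizer (hG : Nat.card G = 112) {b z : G} (hb : orderOf b = 7)
    (hzb : z * b = b * z) {V : Subgroup G} (hV : Nat.card V = 16) (hVz : V ≤ centralizer {z})
    (g : G) : Commute z g := by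
  have h1 : 16 ∣ Nat.card (centralizer {z} : Subgroup G) := hV ▸ card_dvd_of_le hVz
  have h2 : 7 ∣ Nat.card (centralizer {z} : Subgroup G) :=
    hb ▸ orderOf_dvd_of_mem (mem_centralizer_singleton_iff.2 hzb.symm)
  have h3 : Nat.card (centralizer {z} : Subgroup G) ∣ 112 := hG ▸ card_subgroup_dvd_card _
  have h4 : centralizer {z} = (⊤ : Subgroup G) := by
    apply eq_top_of_card_eq
    rw [hG]
    exact Nat.dvd_antisymm h3 (Nat.Coprime.mul_dvd_of_dvd_of_dvd (by norm_num) h1 h2)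
  have h5 : g ∈ centralizer {z} := h4 ▸ mem_top g
  exact (mem_centralizer_singleton_iff.1 h5).symm

/-- The involution normalizing `⟨b⟩` cannot invert `b`, by `FixedPointFree.not_inverted`; hence it
commutes with `b` and acts trivially on `D`. Its centralizer contains `b` and the group `⟨z⟩D` of
order 16, hence is all of `G`. -/
theorem hasCentralInvolution_of_normal_eight (hG : Nat.card G = 112)
    (hnormal : ∀ P : Sylow 7 G, ¬ (P : Subgroup G).Normal) (D : Subgroup G) [hD : D.Normal]
    (hcard : Nat.card D = 8) : HasCentralInvolution G := by
  have : Fact (Nat.Prime 2) := ⟨Nat.prime_two⟩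
  obtain ⟨b, hb⟩ := exists_orderOf_eq_seven hG
  have hfpf := fixedPointFree_conj hG hnormal hb D hcard
  obtain ⟨z, hz2, hz1, hzb⟩ := exists_involution hG hnormal hb
  have hmem : ∀ e ∈ D, MulAut.conj z e ∈ D := fun e he => hD.conj_mem e he z
  have hzb' : z * b = b * z := by
    rcases hzb with h | h
    · exact h
    · refine (hfpf.not_inverted hmem ?_).elim
      rw [← map_pow, ← map_mul, ← map_mul, h]
  have hzD : z ∉ D := by
    intro hz
    refine hz1 (hfpf.eq_one z hz ?_)
    rw [MulAut.conj_apply, ← hzb', mul_inv_cancel_right]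
  have hfix : ∀ e ∈ D, z * e = e * z := by
    intro e he
    have := hfpf.apply_eq_self_of_commute (ψ := MulAut.conj z)
      (by rw [← map_mul, hz2, map_one]) hmem (by rw [← map_mul, ← map_mul, hzb']) he
    exact mul_inv_eq_iff_eq_mul.1 this
  have hzord : orderOf z = 2 := orderOf_eq_prime (by rw [pow_two, hz2]) hz1
  have hDp : IsPGroup 2 D := IsPGroup.of_card (n := 3) (by rw [hcard]; norm_num)
  have hzp : IsPGroup 2 (zpowers z) :=
    IsPGroup.of_card (n := 1) (by rw [Nat.card_zpowers, hzord, pow_one])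
  have hV : Nat.card (zpowers z ⊔ D : Subgroup G) = 16 := by
    have hp : IsPGroup 2 (zpowers z ⊔ D : Subgroup G) := hzp.to_sup_of_normal_right hDp
    obtain ⟨n, hn⟩ := IsPGroup.iff_card.1 hp
    have h1 : Nat.card (zpowers z ⊔ D : Subgroup G) ∣ 112 := hG ▸ card_subgroup_dvd_card _
    have h2 : 8 ∣ Nat.card (zpowers z ⊔ D : Subgroup G) := hcard ▸ card_dvd_of_le le_sup_right
    have h3 : Nat.card (zpowers z ⊔ D : Subgroup G) ≠ 8 := by
      intro h8
      have : D = zpowers z ⊔ D := eq_of_le_of_card_ge le_sup_right (by rw [h8, hcard])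
      exact hzD (this ▸ (le_sup_left : zpowers z ≤ zpowers z ⊔ D) (mem_zpowers z))
    have h4 : Nat.card (zpowers z ⊔ D : Subgroup G) ∣ 16 := by
      rw [hn] at h1 ⊢
      exact (Nat.Coprime.pow_left n (by norm_num : Nat.Coprime 2 7)).dvd_of_dvd_mul_right
        (show 2 ^ n ∣ 16 * 7 from h1)
    obtain ⟨k, hk⟩ := h2
    rw [hk] at h3 h4 ⊢
    have : k ∣ 2 := Nat.dvd_of_mul_dvd_mul_left (show 0 < 8 by norm_num) h4
    rcases (Nat.dvd_prime Nat.prime_two).1 this with rfl | rfl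
    · exact absurd rfl h3
    · rfl
  have hcomm : ∀ g, Commute z g := by
    refine commute_of_le_centralizer hG hb hzb' hV (sup_le ?_ ?_)
    · exact zpowers_le.2 (mem_centralizer_singleton_iff.2 rfl)
    · exact fun e he => mem_centralizer_singleton_iff.2 (hfix e he).symm
  have hzn : (zpowers z).Normal := by
    rw [← normalizer_eq_top_iff, eq_top_iff]
    intro g _
    rw [zpowers_eq_closure]
    have : g ∈ centralizer (closure {z} : Set G) := by
      rw [centralizer_closure]
      exact mem_centralizer_singleton_iff.2 (hcomm g).eq.symm
    exact centralizer_le_normalizer _ this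
  exact ⟨z, hz2, hz1, hcomm, zpowers z ⊔ D, inferInstance, hV,
    (le_sup_left : zpowers z ≤ zpowers z ⊔ D) (mem_zpowers z)⟩

/-- The fixed points of `b` in `V` are exactly `⟨z⟩`. Either `z` is central in `V`, and then in `G`,
or `b` has no nontrivial fixed point in the center of `V`, which therefore has order 8 and is normal
in `G`. -/
theorem hasCentralInvolution_of_normal_sixteen (hG : Nat.card G = 112)
    (hnormal : ∀ P : Sylow 7 G, ¬ (P : Subgroup G).Normal) (V : Subgroup G) [hVn : V.Normal]
    (hV : Nat.card V = 16) : HasCentralInvolution G := by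
  have : Fact (Nat.Prime 2) := ⟨Nat.prime_two⟩
  obtain ⟨b, hb⟩ := exists_orderOf_eq_seven hG
  obtain ⟨z, hz2, hz1, hzb⟩ := exists_involution hG hnormal hb
  have hzV : z ∈ V := by
    have h1 : (z : G ⧸ V) ^ 7 = 1 := by
      have h2 : V.index = 7 := by
        have := V.card_mul_index
        rw [hV, hG] at this
        omega
      rw [← h2]
      exact pow_card_eq_one'
    have h3 : (z : G ⧸ V) ^ 2 = 1 := by
      rw [← QuotientGroup.mk_pow, pow_two, hz2, QuotientGroup.mk_one]
    rw [← QuotientGroup.eq_one_iff]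
    calc (z : G ⧸ V) = (z : G ⧸ V) ^ 7 * ((z : G ⧸ V) ^ 2)⁻¹ ^ 3 := by group
      _ = 1 := by rw [h1, h3]; simp
  have hbV : ∀ n : ℕ, ¬ 7 ∣ n → b ^ n ∉ V := by
    intro n hn hbn
    have h1 := orderOf_dvd_of_mem hbn
    have h2 : orderOf (b ^ n) = 7 := by
      rw [orderOf_pow, hb, (Nat.Prime.coprime_iff_not_dvd (by norm_num)).2 hn]
    rw [h2, hV] at h1
    exact absurd h1 (by norm_num)
  have hzb' : z * b = b * z := by
    rcases hzb with h | h
    · exact h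
    · exfalso
      -- If `z` inverted `b`, the commutator of `z` and `b` would be `b⁵`; it lies in the normal
      -- subgroup `V`.
      refine hbV 5 (by norm_num) ?_
      have h1 : b ^ 5 = z * (b * z⁻¹ * b⁻¹) := by
        rw [← mul_assoc, ← mul_assoc, h]; group
      rw [h1]
      exact mul_mem hzV (hVn.conj_mem _ (inv_mem hzV) b)
  have hbC := card_centralizer_dvd hG hnormal hb
  have hVC : V ⊓ centralizer {b} = zpowers z := by
    symm
    apply eq_of_le_of_card_ge
    · exact zpowers_le.2 ⟨hzV, mem_centralizer_singleton_iff.2 hzb'⟩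
    · rw [Nat.card_zpowers, orderOf_eq_prime (by rw [pow_two, hz2]) hz1]
      refine Nat.le_of_dvd (by norm_num) (Nat.dvd_gcd (m := 14) (n := 16)
        ((card_dvd_of_le inf_le_right).trans hbC) (hV ▸ card_dvd_of_le inf_le_left))
  have hVp : IsPGroup 2 V := IsPGroup.of_card (n := 4) (by rw [hV]; norm_num)
  have hVnt : Nontrivial V := Finite.one_lt_card_iff_nontrivial.1 (by rw [hV]; norm_num)
  let A : Subgroup G := (center V).map V.subtype
  have hAn : A.Normal := inferInstance
  have hAV : A ≤ V := map_subtype_le _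
  by_cases hzA : z ∈ A
  · refine ⟨z, hz2, hz1, commute_of_le_centralizer hG hb hzb' hV ?_, V, hVn, hV, hzV⟩
    obtain ⟨c, hc, rfl⟩ := hzA
    intro v hv
    rw [mem_centralizer_singleton_iff]
    exact congrArg Subtype.val (mem_center_iff.1 hc ⟨v, hv⟩)
  · have h1 := card_modEq_card_inf_centralizer (hb ▸ pow_orderOf_eq_one b) A
    have h2 : A ⊓ centralizer {b} = ⊥ := by
      rw [eq_bot_iff]
      rintro g ⟨hgA, hgb⟩
      have h3 : g ∈ zpowers z := hVC ▸ ⟨hAV hgA, hgb⟩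
      obtain ⟨k, rfl⟩ := h3
      rw [mem_bot]
      have hz : z ^ (2 : ℤ) = 1 := by rw [zpow_two, hz2]
      rcases Int.even_or_odd' k with ⟨m, rfl | rfl⟩
      · simp only [zpow_mul, hz, one_zpow]
      · simp only [zpow_add, zpow_mul, hz, one_zpow, one_mul, zpow_one] at hgA
        exact absurd hgA hzA
    rw [h2, card_bot] at h1
    have h3 : Nat.card A ∣ 2 ^ 4 := by
      rw [show 2 ^ 4 = 16 by norm_num, ← hV]; exact card_dvd_of_le hAV
    have h4 : Nat.card A ≠ 1 := by
      have := hVp.center_nontrivial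
      rw [Subgroup.card_map_of_injective (subtype_injective V)]
      exact Finite.one_lt_card.ne'
    obtain ⟨n, hn, hn'⟩ := (Nat.dvd_prime_pow Nat.prime_two).1 h3
    -- Among 2, 4, 8, 16 only 8 is congruent to 1 mod 7.
    have h5 : Nat.card A = 8 := by
      rw [hn'] at h1 h4 ⊢
      interval_cases n <;> first | rfl | exact absurd h1 (by decide) | exact absurd rfl h4
    exact hasCentralInvolution_of_normal_eight hG hnormal A h5

theorem card_sylow_two (hG : Nat.card G = 112) (Q : Sylow 2 G) : Nat.card Q = 16 := by
  have : Fact (Nat.Prime 2) := ⟨Nat.prime_two⟩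
  rw [Q.card_eq_multiplicity, hG, show 112 = 2 ^ 4 * 7 by norm_num,
    Nat.factorization_mul (by norm_num) (by norm_num), Nat.Prime.factorization_pow Nat.prime_two]
  simp [Nat.factorization_eq_zero_of_not_dvd (show ¬ 2 ∣ 7 by norm_num)]

end

/-! ### Intersections of Sylow 2-subgroups -/

section

open Subgroup

variable {G : Type*} [Group G] [Finite G]

/-- Among seven Sylow `2`-subgroups of order `16`, some two intersect in a subgroup of order
`8`. -/
theorem exists_card_inf_eq_eight (hG : Nat.card G = 112) (h7 : Nat.card (Sylow 2 G) = 7)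
    (Q : Sylow 2 G) :
    ∃ R : Sylow 2 G, R ≠ Q ∧ Nat.card ((Q : Subgroup G) ⊓ (R : Subgroup G) : Subgroup G) = 8 := by
  classical
  have : Fact (Nat.Prime 2) := ⟨Nat.prime_two⟩
  by_contra! hcon
  have := Fintype.ofFinite (Sylow 2 G)
  have := Fintype.ofFinite (Q : Subgroup G)
  have hQ : Nat.card (Q : Subgroup G) = 16 := card_sylow_two hG Q
  have hstab : ∀ R : Sylow 2 G, Fintype.card (MulAction.stabilizer (Q : Subgroup G) R) =
      Nat.card ((Q : Subgroup G) ⊓ (R : Subgroup G) : Subgroup G) := by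
    intro R
    rw [← Nat.card_eq_fintype_card, ← Q.2.inf_normalizer_sylow R]
    refine Nat.card_congr
      { toFun := fun g => ⟨g.1.1, g.1.2, Sylow.smul_eq_iff_mem_normalizer.1 g.2⟩
        invFun := fun g => ⟨⟨g.1, g.2.1⟩, Sylow.smul_eq_iff_mem_normalizer.2 g.2.2⟩
        left_inv := fun _ => rfl
        right_inv := fun _ => rfl }
  have hself : Nat.card ((Q : Subgroup G) ⊓ (Q : Subgroup G) : Subgroup G) = 16 := by
    rw [inf_idem, hQ]
  have hother : ∀ R : Sylow 2 G, R ≠ Q →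
      4 ∣ 16 / Nat.card ((Q : Subgroup G) ⊓ (R : Subgroup G) : Subgroup G) := by
    intro R hR
    have h1 : Nat.card ((Q : Subgroup G) ⊓ (R : Subgroup G) : Subgroup G) ∣ 2 ^ 4 := by
      rw [show 2 ^ 4 = 16 by norm_num, ← hQ]; exact card_dvd_of_le inf_le_left
    have h2 : Nat.card ((Q : Subgroup G) ⊓ (R : Subgroup G) : Subgroup G) ≠ 16 := by
      intro h16
      have e1 : (Q : Subgroup G) ⊓ (R : Subgroup G) = Q :=
        eq_of_le_of_card_ge inf_le_left (by rw [h16, hQ])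
      exact hR (Sylow.ext (Q.3 R.2 (inf_eq_left.1 e1)))
    have h3 := hcon R hR
    obtain ⟨n, hn, hn'⟩ := (Nat.dvd_prime_pow Nat.prime_two).1 h1
    rw [hn'] at h2 h3 ⊢
    interval_cases n <;> first | exact absurd rfl h2 | exact absurd rfl h3 | decide
  -- `Q` acts by conjugation on the seven Sylow subgroups and fixes itself. If no intersection had
  -- order 8, every other orbit would have length divisible by 4, but 4 does not divide 6.
  have hsum := MulAction.card_eq_sum_card_group_div_card_stabilizer (Q : Subgroup G) (Sylow 2 G)
  rw [← Nat.card_eq_fintype_card, h7, ← Nat.card_eq_fintype_card, hQ] at hsum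
  simp only [hstab] at hsum
  let ω₀ : Quotient (MulAction.orbitRel (Q : Subgroup G) (Sylow 2 G)) := ⟦Q⟧
  have hfixQ : ∀ g : (Q : Subgroup G), g • Q = Q := fun g =>
    Sylow.smul_eq_iff_mem_normalizer.2 (le_normalizer g.2)
  have hout : ω₀.out = Q := by
    have : ω₀.out ∈ MulAction.orbit (Q : Subgroup G) Q :=
      MulAction.orbitRel_apply.1 (Quotient.mk_out Q)
    obtain ⟨g, hg⟩ := this
    rw [← hg]
    exact hfixQ g
  have hne : ∀ ω ≠ ω₀, ω.out ≠ Q := by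
    intro ω hω h
    apply hω
    rw [← Quotient.out_eq ω, h]
  rw [← Finset.add_sum_erase _ _ (Finset.mem_univ ω₀), hout, hself] at hsum
  have hdvd : 4 ∣ ∑ ω ∈ Finset.univ.erase ω₀,
      16 / Nat.card ((Q : Subgroup G) ⊓ (ω.out : Sylow 2 G) : Subgroup G) :=
    Finset.dvd_sum fun ω hω => hother _ (hne ω (Finset.ne_of_mem_erase hω))
  omega

/-- The intersection has index 2 in both Sylow subgroups, so its normalizer contains both. The order
of that normalizer is thus a multiple of 16 other than 16, dividing 112. -/
theorem exists_normal_eight (hG : Nat.card G = 112) (h7 : Nat.card (Sylow 2 G) = 7) :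
    ∃ D : Subgroup G, D.Normal ∧ Nat.card D = 8 := by
  have : Fact (Nat.Prime 2) := ⟨Nat.prime_two⟩
  obtain ⟨Q⟩ : Nonempty (Sylow 2 G) := inferInstance
  obtain ⟨R, hR, hcard⟩ := exists_card_inf_eq_eight hG h7 Q
  refine ⟨(Q : Subgroup G) ⊓ R, ?_, hcard⟩
  have hle : ∀ T : Sylow 2 G, (Q : Subgroup G) ⊓ R ≤ T →
      (T : Subgroup G) ≤ normalizer ((Q : Subgroup G) ⊓ R : Subgroup G) := by
    intro T hT
    have hidx : (((Q : Subgroup G) ⊓ R).subgroupOf T).index = 2 := by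
      have h1 := (((Q : Subgroup G) ⊓ R).subgroupOf T).card_mul_index
      have h2 : Nat.card (((Q : Subgroup G) ⊓ R).subgroupOf (T : Subgroup G)) = 8 := by
        rw [← hcard]
        exact Nat.card_congr (subgroupOfEquivOfLe hT).toEquiv
      rw [h2, card_sylow_two hG T] at h1
      omega
    have := normal_of_index_eq_two hidx
    exact le_normalizer_of_normal_subgroupOf hT
  have hQN := hle Q inf_le_left
  have hRN := hle R inf_le_right
  rw [← normalizer_eq_top_iff]
  apply eq_top_of_card_eq
  rw [hG]
  have h1 := card_dvd_of_le hQN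
  rw [card_sylow_two hG Q] at h1
  have h2 := card_subgroup_dvd_card (normalizer (((Q : Subgroup G) ⊓ R : Subgroup G) : Set G))
  rw [hG] at h2
  have h3 : Nat.card (normalizer (((Q : Subgroup G) ⊓ R : Subgroup G) : Set G)) ≠ 16 := by
    intro h16
    have e1 := eq_of_le_of_card_ge hQN (by rw [h16, card_sylow_two hG Q])
    have e2 := eq_of_le_of_card_ge hRN (by rw [h16, card_sylow_two hG R])
    exact hR (Sylow.ext (e2.trans e1.symm))
  obtain ⟨k, hk⟩ := h1
  rw [hk] at h2 h3 ⊢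
  have h4 : k ∣ 7 := Nat.dvd_of_mul_dvd_mul_left (show 0 < 16 by norm_num) h2
  rcases (Nat.dvd_prime (by norm_num)).1 h4 with rfl | rfl
  · exact absurd rfl h3
  · rfl

theorem hasCentralInvolution (hG : Nat.card G = 112)
    (hnormal : ∀ P : Sylow 7 G, ¬ (P : Subgroup G).Normal) : HasCentralInvolution G := by
  have : Fact (Nat.Prime 2) := ⟨Nat.prime_two⟩
  obtain ⟨Q⟩ : Nonempty (Sylow 2 G) := inferInstance
  have h1 := Q.card_dvd_index
  have h2 := (Q : Subgroup G).card_mul_index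
  rw [card_sylow_two hG Q, hG] at h2
  have h3 : (Q : Subgroup G).index = 7 := by omega
  rw [h3] at h1
  rcases (Nat.dvd_prime (by norm_num)).1 h1 with h | h
  · have := (Nat.card_eq_one_iff_unique.1 h).1
    have := Q.normal_of_subsingleton
    exact hasCentralInvolution_of_normal_sixteen hG hnormal Q (card_sylow_two hG Q)
  · obtain ⟨D, hD, hcard⟩ := exists_normal_eight hG h
    exact hasCentralInvolution_of_normal_eight hG hnormal D hcard

end

open Subgroup

/-! ### Deriving the relations, and the subgroups they describe -/

section relations

variable {G : Type*} [Group G]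

theorem conj_pow_apply (b : G) (k : ℕ) (v : G) :
    (MulAut.conj b ^ k) v = b ^ k * v * (b ^ k)⁻¹ := by
  rw [← map_pow, MulAut.conj_apply]

/-- The relation `x₀x₁ = x₃` together with central squares forces all of `Rel`. -/
theorem rel_of_mul_conj {b x z s : G} (hb : orderOf b = 7) (hz2 : z * z = 1)
    (hz : ∀ g, Commute z g) (hs : ∀ g, Commute s g) (hs2 : s * s = 1) (hxs : x * x = s)
    (hrel : x * (b * x * b⁻¹) = b ^ 3 * x * (b ^ 3)⁻¹) : Rel b x z := by
  have hb7 : b ^ 7 = 1 := hb ▸ pow_orderOf_eq_one b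
  obtain ⟨y, hy⟩ : ∃ y : ℕ → G, ∀ i, y i = b ^ i * x * (b ^ i)⁻¹ := ⟨_, fun _ => rfl⟩
  have hy0 : y 0 = x := by simp [hy]
  have hy7 : y 7 = x := by simp [hy, hb7]
  have hy8 : y 8 = y 1 := by simp [hy, show b ^ 8 = b by rw [pow_succ, hb7, one_mul]]
  have hsq : ∀ i, y i * y i = s := by
    intro i
    have h1 : y i * y i = b ^ i * (x * x) * (b ^ i)⁻¹ := by rw [hy]; group
    rw [h1, hxs, ← (hs _).eq, mul_inv_cancel_right]
  have hmul : ∀ i, y i * y (i + 1) = y (i + 3) := by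
    intro i
    have h1 : y i * y (i + 1) = b ^ i * (x * (b * x * b⁻¹)) * (b ^ i)⁻¹ := by
      rw [hy, hy, pow_succ]; group
    rw [h1, hrel, hy, pow_add]; group
  -- With `y₃ = y₀y₁`, the square of `y₃` gives `y₁y₀y₁ = y₀`. Expanding `y₄y₅ = (y₁y₂)(y₂y₀y₁)`
  -- gives `s * y₀`, while `y₄y₅ = y₇ = y₀`.
  have hs1 : s = 1 := by
    have h1 : y 1 * y 0 * y 1 = y 0 := by
      have h2 := hsq 3
      rw [← hmul 0, zero_add] at h2
      have h3 : y 0 * (y 1 * y 0 * y 1) = y 0 * y 0 := by rw [hsq 0, ← h2]; simp only [mul_assoc]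
      exact mul_left_cancel h3
    have h4 : y 4 * y 5 = s * y 0 := by
      rw [← hmul 1, ← hmul 2, ← hmul 0]
      calc y 1 * y 2 * (y 2 * (y 0 * y 1)) = y 1 * (y 2 * y 2) * y 0 * y 1 := by
            simp only [mul_assoc]
        _ = s * (y 1 * y 0 * y 1) := by rw [hsq, ← (hs (y 1)).eq]; simp only [mul_assoc]
        _ = _ := by rw [h1]
    rw [hmul 4, hy7, hy0] at h4
    exact (mul_eq_right.1 h4.symm)
  subst hs1
  have hcomm : ∀ i, y i * y (i + 1) = y (i + 1) * y i := fun i =>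
    mul_comm_of_mul_self (hsq i) (hsq _) (by rw [hmul, hsq])
  have h02 : y 0 * y 2 = y 2 * y 0 := by
    refine mul_comm_of_mul_self (hsq 0) (hsq 2) ?_
    have : y 6 = y 0 * y 2 := by
      rw [← hmul 3, ← hmul 0, ← hmul 1, mul_assoc, ← mul_assoc (y 1), hsq, one_mul]
    rw [← this, hsq]
  have h1 : y 1 = b * x * b⁻¹ := by rw [hy, pow_one]
  exact
    { b_pow := hb7
      z_sq := hz2
      z_comm := hz
      x_sq := hxs
      comm_one := by
        have := hcomm 0
        rwa [hy0, zero_add, h1] at this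
      comm_two := by
        rwa [hy0, hy 2] at h02
      rel := hrel.symm }

theorem Rel.conj_pow {b x z : G} (h : Rel b x z) (i : ℕ) :
    Rel b (b ^ i * x * (b ^ i)⁻¹) z := by
  have key : ∀ k : ℕ, b ^ k * (b ^ i * x * (b ^ i)⁻¹) * (b ^ k)⁻¹ =
      MulAut.conj (b ^ i) (b ^ k * x * (b ^ k)⁻¹) := by
    intro k
    have : b ^ k * b ^ i = b ^ i * b ^ k := (Commute.pow_pow_self b k i).eq
    calc _ = (b ^ k * b ^ i) * x * (b ^ k * b ^ i)⁻¹ := by group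
      _ = _ := by rw [this, MulAut.conj_apply]; group
  have key1 := key 1
  rw [pow_one] at key1
  have key0 : b ^ i * x * (b ^ i)⁻¹ = MulAut.conj (b ^ i) x := rfl
  refine ⟨h.b_pow, h.z_sq, h.z_comm, conj_mul_self_eq_one h.x_sq _, ?_, ?_, ?_⟩
  · rw [key1, key0]; exact h.comm_one.map _
  · rw [key 2, key0]; exact h.comm_two.map _
  · rw [key 3, key1, key0, ← map_mul, h.rel]

/-- The image of `enc`. -/
def encRange {b x z : G} (h : Rel b x z) : Subgroup G where
  carrier := Set.range (enc b x z)
  mul_mem' := by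
    rintro _ _ ⟨m, rfl⟩ ⟨n, rfl⟩
    exact ⟨m.mul n, enc_mul h m n⟩
  one_mem' := ⟨Model.one, enc_one⟩
  inv_mem' := by
    rintro _ ⟨m, rfl⟩
    exact ⟨m.inv, enc_inv h m⟩

theorem left_mem_encRange {b x z : G} (h : Rel b x z) : b ∈ encRange h :=
  ⟨((false, false, false, false), 1), by simp [enc, encVec, bpow]⟩

theorem mid_mem_encRange {b x z : G} (h : Rel b x z) : x ∈ encRange h :=
  ⟨((true, false, false, false), 0), by simp [enc, encVec, bpow]⟩

theorem right_mem_encRange {b x z : G} (h : Rel b x z) : z ∈ encRange h :=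
  ⟨((false, false, false, true), 0), by simp [enc, encVec, bpow]⟩

theorem bpow_mem {H : Subgroup G} {x : G} (hx : x ∈ H) (p : Bool) : bpow x p ∈ H := by
  cases p
  · exact one_mem H
  · exact hx

theorem enc_mem {H : Subgroup G} {b x z : G} (hb : b ∈ H) (hx : x ∈ H) (hz : z ∈ H) (m : Model) :
    enc b x z m ∈ H := by
  obtain ⟨⟨p, q, r, s⟩, i⟩ := m
  refine mul_mem (mul_mem (mul_mem (mul_mem ?_ ?_) ?_) ?_) (pow_mem hb _)
  · exact bpow_mem hx _
  · exact bpow_mem (mul_mem (mul_mem hb hx) (inv_mem hb)) _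
  · exact bpow_mem (mul_mem (mul_mem (pow_mem hb _) hx) (inv_mem (pow_mem hb _))) _
  · exact bpow_mem hz _

theorem rot_iterate_last (n : ℕ) (v : Vec) : (Vec.rot^[n] v).2.2.2 = v.2.2.2 := by
  induction n with
  | zero => rfl
  | succ n ih => rw [Function.iterate_succ_apply', ← ih]; rfl

/-- The subgroup of the image of `enc` with vanishing `𝔽₂`-coordinate. -/
def encRangeZero {b x z : G} (h : Rel b x z) : Subgroup G where
  carrier := enc b x z '' {m | m.1.2.2.2 = false}
  mul_mem' := by
    rintro _ _ ⟨m, hm, rfl⟩ ⟨n, hn, rfl⟩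
    refine ⟨m.mul n, ?_, enc_mul h m n⟩
    have : (m.mul n).1.2.2.2 = (m.1.2.2.2 ^^ (Vec.rot^[m.2] n.1).2.2.2) := rfl
    rw [Set.mem_ofPred_eq] at hm hn ⊢
    rw [this, rot_iterate_last, hm, hn]; rfl
  one_mem' := ⟨Model.one, rfl, enc_one⟩
  inv_mem' := by
    rintro _ ⟨m, hm, rfl⟩
    exact ⟨m.inv, (rot_iterate_last _ _).trans hm, enc_inv h m⟩

/-- Three bits and an exponent mod 7 describe at most 56 elements. -/
theorem encRangeZero_ne_top {b x z : G} (h : Rel b x z) (hG : Nat.card G = 112) :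
    encRangeZero h ≠ ⊤ := by
  intro htop
  let f : Bool × Bool × Bool × Fin 7 → G := fun t =>
    enc b x z ((t.1, t.2.1, t.2.2.1, false), t.2.2.2)
  have hf : Function.Surjective f := by
    intro g
    have hg : g ∈ encRangeZero h := htop ▸ mem_top g
    obtain ⟨⟨⟨p, q, r, s⟩, i⟩, hs, rfl⟩ := hg
    obtain rfl : s = false := hs
    exact ⟨(p, q, r, i), rfl⟩
  have := Nat.card_le_card_of_surjective f hf
  rw [hG] at this
  simp at this

end relations

/-! ### The action of `b` modulo the central involution -/

section

open Subgroup

variable {G : Type*} [Group G]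

/-- The standing data: a central involution in a normal subgroup of order `16`. -/
structure Setting (z : G) (V : Subgroup G) : Prop where
  card : Nat.card G = 112
  nonnormal : ∀ P : Sylow 7 G, ¬ (P : Subgroup G).Normal
  sq : z * z = 1
  ne_one : z ≠ 1
  comm : ∀ g, Commute z g
  normal : V.Normal
  card_V : Nat.card V = 16
  mem : z ∈ V

variable {z : G} {V : Subgroup G}

theorem mem_zpowers_iff_of_sq (hz : z * z = 1) {g : G} : g ∈ zpowers z ↔ g = 1 ∨ g = z := by
  constructor
  · rintro ⟨k, rfl⟩
    have h2 : z ^ (2 : ℤ) = 1 := by rw [zpow_two, hz]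
    rcases Int.even_or_odd' k with ⟨m, rfl | rfl⟩
    · left; simp only [zpow_mul, h2, one_zpow]
    · right; simp only [zpow_add, zpow_mul, h2, one_zpow, one_mul, zpow_one]
  · rintro (rfl | rfl)
    · exact one_mem _
    · exact mem_zpowers _

theorem Setting.normal_zpowers (h : Setting z V) : (zpowers z).Normal where
  conj_mem n hn g := by
    rcases (mem_zpowers_iff_of_sq h.sq).1 hn with rfl | rfl
    · simp
    · rw [← (h.comm g).eq, mul_inv_cancel_right]; exact hn

theorem Setting.orderOf_eq_two (h : Setting z V) : orderOf z = 2 :=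
  orderOf_eq_prime (by rw [pow_two, h.sq]) h.ne_one

variable [Finite G]

theorem Setting.eq_one_or_eq (h : Setting z V) {b : G} (hb : orderOf b = 7) {v : G} (hv : v ∈ V)
    (hc : v * b = b * v) : v = 1 ∨ v = z := by
  have hVC : zpowers z = V ⊓ centralizer {b} := by
    apply eq_of_le_of_card_ge
    · exact zpowers_le.2 ⟨h.mem, mem_centralizer_singleton_iff.2 (h.comm b).eq⟩
    · rw [Nat.card_zpowers, h.orderOf_eq_two]
      exact Nat.le_of_dvd (by norm_num) (Nat.dvd_gcd (m := 14) (n := 16)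
        ((card_dvd_of_le inf_le_right).trans (card_centralizer_dvd h.card h.nonnormal hb))
        (h.card_V ▸ card_dvd_of_le inf_le_left))
  rw [← mem_zpowers_iff_of_sq h.sq, hVC]
  exact ⟨hv, mem_centralizer_singleton_iff.2 hc⟩

theorem Setting.fixedPointFree (h : Setting z V) {b : G} (hb : orderOf b = 7)
    [(zpowers z).Normal] :
    FixedPointFree (MulAut.conj (b : G ⧸ zpowers z)) (V.map (QuotientGroup.mk' (zpowers z))) where
  card := by
    have h1 : (V.map (QuotientGroup.mk' (zpowers z))).index = V.index := by
      refine index_map_eq V (QuotientGroup.mk'_surjective _) ?_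
      rw [QuotientGroup.ker_mk', zpowers_le]
      exact h.mem
    have h2 := V.card_mul_index
    have h3 := (V.map (QuotientGroup.mk' (zpowers z))).card_mul_index
    have h4 := card_eq_card_quotient_mul_card_subgroup (zpowers z)
    rw [h.card, Nat.card_zpowers, h.orderOf_eq_two] at h4
    rw [h.card_V, h.card] at h2
    rw [h1] at h3
    have h5 : V.index = 7 := by omega
    rw [h5] at h3
    omega
  pow_seven := by
    rw [← map_pow, ← QuotientGroup.mk_pow, ← hb, pow_orderOf_eq_one, QuotientGroup.mk_one, map_one]
  map_mem := by
    rintro _ ⟨v, hv, rfl⟩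
    exact ⟨b * v * b⁻¹, h.normal.conj_mem v hv b, rfl⟩
  eq_one := by
    rintro _ ⟨v, hv, rfl⟩ he
    have h1 : ((b * v * b⁻¹ : G) : G ⧸ zpowers z) = v := he
    have h2 := QuotientGroup.eq.1 h1.symm
    have h3 : MulAut.conj b v = v := by
      rcases (mem_zpowers_iff_of_sq h.sq).1 h2 with h3 | h3
      · rw [inv_mul_eq_one] at h3
        exact h3.symm
      · rw [inv_mul_eq_iff_eq_mul] at h3
        -- If `b` sends `v` to `v * z`, then `b²` fixes `v`, and so does `b`, as conjugation by `b`
        -- has seventh power 1.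
        apply apply_eq_self_of_pow_apply (conj_pow_seven hb) (n := 2) (by norm_num)
        rw [pow_two, MulAut.mul_apply, MulAut.conj_apply, MulAut.conj_apply, h3]
        calc b * (v * z) * b⁻¹ = (b * v * b⁻¹) * (b * z * b⁻¹) := by group
          _ = v := by rw [h3, ← (h.comm b).eq, mul_inv_cancel_right, mul_assoc, h.sq, mul_one]
    rcases h.eq_one_or_eq hb hv (mul_inv_eq_iff_eq_mul.1 h3).symm with rfl | rfl
    · rfl
    · exact (QuotientGroup.eq_one_iff _).2 (mem_zpowers _)

theorem Setting.rel_of_quotient (h : Setting z V) [(zpowers z).Normal] {b : G} (hb : orderOf b = 7)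
    {v : G} (hv : v ∈ V) (hrel : ((v * (b * v * b⁻¹) : G) : G ⧸ zpowers z) =
      ((b ^ 3 * v * (b ^ 3)⁻¹ : G) : G ⧸ zpowers z)) :
    ∃ f : Bool, Rel b (v * bpow z f) z := by
  have hsq : v * v = 1 ∨ v * v = z := by
    rw [← mem_zpowers_iff_of_sq h.sq, ← QuotientGroup.eq_one_iff]
    exact (h.fixedPointFree hb).mul_self ⟨v, hv, rfl⟩
  have hs : (∀ g, Commute (v * v) g) ∧ (v * v) * (v * v) = 1 := by
    rcases hsq with h1 | h1 <;> rw [h1]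
    · simp
    · exact ⟨h.comm, h.sq⟩
  rcases (mem_zpowers_iff_of_sq h.sq).1 (QuotientGroup.eq.1 hrel) with h1 | h1
  · refine ⟨false, ?_⟩
    rw [bpow, cond_false, mul_one]
    exact rel_of_mul_conj hb h.sq h.comm hs.1 hs.2 rfl (inv_mul_eq_one.1 h1)
  -- When the relation fails by `z`, replacing `v` by `v * z` repairs it: the left side gains `z² =
  -- 1`, the right side gains `z`.
  · refine ⟨true, ?_⟩
    rw [bpow, cond_true]
    rw [inv_mul_eq_iff_eq_mul] at h1
    have hz : ∀ c : G, c * (v * z) * c⁻¹ = c * v * c⁻¹ * z := fun c => by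
      calc c * (v * z) * c⁻¹ = c * v * (z * c⁻¹) := by group
        _ = _ := by rw [(h.comm c⁻¹).eq]; group
    refine rel_of_mul_conj hb h.sq h.comm hs.1 hs.2 ?_ ?_
    · calc v * z * (v * z) = v * (z * v) * z := by group
        _ = v * v * (z * z) := by rw [(h.comm v).eq]; group
        _ = _ := by rw [h.sq, mul_one]
    · rw [hz, hz, h1]
      calc v * z * (b * v * b⁻¹ * z) = v * (z * (b * v * b⁻¹)) * z := by group
        _ = _ := by rw [(h.comm _).eq]; group

theorem Setting.exists_rel (h : Setting z V) {b : G} (hb : orderOf b = 7) {v : G} (hv : v ∈ V)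
    (hv1 : v ≠ 1) (hvz : v ≠ z) :
    ∃ b', (b' = b ∨ b' = b⁻¹) ∧ ∃ f : Bool, Rel b' (v * bpow z f) z := by
  have := h.normal_zpowers
  have hfpf := h.fixedPointFree hb
  have hvV : (v : G ⧸ zpowers z) ∈ V.map (QuotientGroup.mk' (zpowers z)) := ⟨v, hv, rfl⟩
  have hne : (v : G ⧸ zpowers z) ≠ 1 := by
    rw [Ne, QuotientGroup.eq_one_iff, mem_zpowers_iff_of_sq h.sq]
    tauto
  have hmk : ∀ k : ℕ, (MulAut.conj (b : G ⧸ zpowers z) ^ k) (v : G ⧸ zpowers z) =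
      ((b ^ k * v * (b ^ k)⁻¹ : G) : G ⧸ zpowers z) := fun k => conj_pow_apply _ _ _
  have hb7 : b ^ 7 = 1 := hb ▸ pow_orderOf_eq_one b
  rcases hfpf.mul_apply hvV hne with hk | hk
  · rw [hmk 3] at hk
    exact ⟨b, Or.inl rfl, h.rel_of_quotient hb hv hk⟩
  -- Shifting `y₀y₁ = y₅` gives `y₆y₀ = y₄`, which is the desired relation for `b⁻¹`.
  · have h6 := hfpf.pow_mul hk 6
    rw [show 6 + 1 = 7 by norm_num, hfpf.pow_seven, MulAut.one_apply,
      hfpf.mul_comm (hfpf.pow_map_mem 6 hvV) hvV, show (6 + 5) % 7 = 4 by norm_num, hmk, hmk] at h6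
    have e1 : b ^ 6 = b⁻¹ := eq_inv_of_mul_eq_one_left (by rw [← pow_succ, hb7])
    have e2 : b ^ 4 = b⁻¹ ^ 3 := by
      rw [inv_pow]
      exact eq_inv_of_mul_eq_one_left (by rw [← pow_add, hb7])
    rw [e1, e2] at h6
    exact ⟨b⁻¹, Or.inr rfl, h.rel_of_quotient (by rw [orderOf_inv, hb]) hv h6⟩

theorem Setting.sup_zpowers (h : Setting z V) {b : G} (hb : orderOf b = 7) :
    V ⊔ zpowers b = ⊤ := by
  refine (isComplement'_of_coprime ?_ ?_).sup_eq_top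
  · rw [h.card_V, Nat.card_zpowers, hb, h.card]
  · rw [h.card_V, Nat.card_zpowers, hb]; norm_num

/-- Conjugates of `x` by powers of `b` represent all nontrivial cosets of `⟨z⟩` in `V`, so the image
contains `V` and `b`. -/
theorem Setting.enc_surjective (h : Setting z V) {b x : G} (hb : orderOf b = 7) (hr : Rel b x z)
    (hx : x ∈ V) (hx1 : x ≠ 1) (hxz : x ≠ z) : Function.Surjective (enc b x z) := by
  have := h.normal_zpowers
  have hfpf := h.fixedPointFree hb
  have hne : ∀ {v : G}, v ≠ 1 → v ≠ z → (v : G ⧸ zpowers z) ≠ 1 := by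
    intro v h1 h2
    rw [Ne, QuotientGroup.eq_one_iff, mem_zpowers_iff_of_sq h.sq]
    tauto
  have hbR := left_mem_encRange hr
  have hxR := mid_mem_encRange hr
  have hzR := right_mem_encRange hr
  have hV : V ≤ encRange hr := by
    intro v hv
    by_cases hv1 : v = 1
    · exact hv1 ▸ one_mem _
    by_cases hvz : v = z
    · exact hvz ▸ hzR
    obtain ⟨i, -, hi⟩ := hfpf.exists_pow_apply ⟨x, hx, rfl⟩ (hne hx1 hxz) ⟨v, hv, rfl⟩
      (hne hv1 hvz)
    have hi' : (v : G ⧸ zpowers z) = ((b ^ i * x * (b ^ i)⁻¹ : G) : G ⧸ zpowers z) :=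
      hi.trans (conj_pow_apply _ _ _)
    have h2 : (b ^ i * x * (b ^ i)⁻¹)⁻¹ * v ∈ encRange hr :=
      (zpowers_le.2 hzR) (QuotientGroup.eq.1 hi'.symm)
    have h3 : b ^ i * x * (b ^ i)⁻¹ ∈ encRange hr :=
      mul_mem (mul_mem (pow_mem hbR i) hxR) (inv_mem (pow_mem hbR i))
    exact (mul_mem_cancel_left (inv_mem h3)).1 h2
  have htop : (⊤ : Subgroup G) ≤ encRange hr :=
    h.sup_zpowers hb ▸ sup_le hV (zpowers_le.2 hbR)
  exact fun g => htop (mem_top g)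

end

/-! ### Extracting suitable generators from a connected Cayley graph -/

section

open Subgroup

variable {G : Type*} [Group G]

theorem closure_eq_top_of_connected {S : Set G} (hS : (SimpleGraph.mulCayley S).Connected) :
    closure S = ⊤ := by
  have key : ∀ {u v : G}, (SimpleGraph.mulCayley S).Walk u v → (u ∈ closure S → v ∈ closure S) := by
    intro u v p
    induction p with
    | nil => exact id
    | cons hadj _ ih =>
      intro hu
      apply ih
      rw [SimpleGraph.mulCayley_adj] at hadj
      rcases hadj.2 with h | h
      · exact (mul_mem_cancel_left (inv_mem hu)).1 (subset_closure h)
      · have := mul_mem hu (inv_mem (subset_closure h))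
        rwa [mul_inv_rev, inv_inv, mul_inv_cancel_left] at this
  rw [eq_top_iff]
  intro g _
  obtain ⟨p⟩ := hS.preconnected 1 g
  exact key p (one_mem _)

theorem exists_notMem_of_connected {S : Set G} (hS : (SimpleGraph.mulCayley S).Connected)
    {H : Subgroup G} (hH : H ≠ ⊤) : ∃ s ∈ S, s ∉ H := by
  by_contra! hcon
  exact hH (top_le_iff.1 (closure_eq_top_of_connected hS ▸ (closure_le H).2 hcon))

variable [Finite G] {z : G} {V : Subgroup G}

theorem Setting.exists_eq_mul_pow (h : Setting z V) {b : G} (hb : orderOf b = 7) (g : G) :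
    ∃ v ∈ V, ∃ j : Fin 7, g = v * b ^ (j : ℕ) := by
  have := h.normal
  have hg : g ∈ V ⊔ zpowers b := h.sup_zpowers hb ▸ mem_top g
  obtain ⟨v, hv, c, hc, rfl⟩ := mem_sup_of_normal_left.1 hg
  classical
  rw [← mem_powers_iff_mem_zpowers, mem_powers_iff_mem_range_orderOf, hb] at hc
  obtain ⟨k, hk, rfl⟩ := Finset.mem_image.1 hc
  exact ⟨v, hv, ⟨k, Finset.mem_range.1 hk⟩, rfl⟩

theorem Setting.exists_eq_bpow_mul (h : Setting z V) {a : G} (ha : a ∉ V) :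
    ∃ b, orderOf b = 7 ∧ ∃ e : Bool, a = bpow z e * b := by
  have := h.normal
  have hidx : V.index = 7 := by
    have := V.card_mul_index
    rw [h.card_V, h.card] at this
    omega
  have ha7 : a ^ 7 ∈ V := by
    rw [← QuotientGroup.eq_one_iff, QuotientGroup.mk_pow, ← hidx]
    exact pow_card_eq_one'
  -- The exponent 64 is 1 mod 7 and 0 mod 16, so `a ^ 64` is the part of `a` of order 7.
  have hb1 : a ^ 64 ≠ 1 := by
    intro h64
    apply ha
    have h9 : a ^ 64 * (a ^ 7) ^ (-9 : ℤ) = a := by group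
    rw [h64, one_mul] at h9
    exact h9 ▸ zpow_mem ha7 _
  have hb7 : (a ^ 64) ^ 7 = 1 := by
    have h1 : (a ^ 7) ^ 16 = 1 := by
      rw [← orderOf_dvd_iff_pow_eq_one, ← h.card_V]
      exact orderOf_dvd_of_mem ha7
    calc (a ^ 64) ^ 7 = ((a ^ 7) ^ 16) ^ 4 := by simp only [← pow_mul]
      _ = 1 := by rw [h1, one_pow]
  have hb : orderOf (a ^ 64) = 7 := by
    have : Fact (Nat.Prime 7) := ⟨by norm_num⟩
    exact orderOf_eq_prime hb7 hb1
  refine ⟨a ^ 64, hb, ?_⟩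
  have hc : a ^ 7 * a ^ 64 = a ^ 64 * a ^ 7 := (Commute.pow_pow_self a 7 64).eq
  have hdecomp : a * (a ^ 7) ^ 9 = a ^ 64 := by rw [← pow_mul, ← pow_succ']
  rcases h.eq_one_or_eq hb ha7 hc with h1 | h1
  · refine ⟨false, ?_⟩
    rw [h1, one_pow, mul_one] at hdecomp
    rw [← hdecomp, bpow, cond_false, one_mul]
  · refine ⟨true, ?_⟩
    have hz9 : z ^ 9 = z := by
      rw [pow_succ, show 8 = 2 * 4 by norm_num, pow_mul, pow_two, h.sq, one_pow, one_mul]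
    rw [h1, hz9] at hdecomp
    rw [← hdecomp, bpow, cond_true, ← (h.comm _).eq, ← mul_assoc, h.sq, one_mul]

theorem Setting.exists_rel_of_pair (h : Setting z V) {b : G} (hb : orderOf b = 7) (e : Bool) {t : G}
    (ht : t * b ≠ b * t) {S : Set G} (hS : bpow z e * b ∈ S ∪ S⁻¹) :
    ∃ b' x : G, (b' = b ∨ b' = b⁻¹) ∧ Rel b' x z ∧ Function.Surjective (enc b' x z) ∧
      enc b' x z ((false, false, false, e), 1) ∈ S ∪ S⁻¹ ∧
      ∃ (f : Bool) (j : Fin 7), enc b' x z ((true, false, false, f), j) = t := by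
  obtain ⟨v, hv, i, hi⟩ := h.exists_eq_mul_pow hb t
  have hv1 : v ≠ 1 := by
    rintro rfl
    apply ht
    rw [hi, one_mul, ← pow_succ, ← pow_succ']
  have hvz : v ≠ z := by
    rintro rfl
    apply ht
    rw [hi, mul_assoc, ← pow_succ, ← mul_assoc, ← (h.comm b).eq, mul_assoc, ← pow_succ']
  have hz2 : ∀ p, bpow z p * bpow z p = 1 := fun p => by cases p <;> simp [bpow, h.sq]
  obtain ⟨b', hb', f, hr⟩ := h.exists_rel hb hv hv1 hvz
  have hbord : orderOf b' = 7 := by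
    rcases hb' with rfl | rfl
    · exact hb
    · rw [orderOf_inv, hb]
  have hxV : v * bpow z f ∈ V := mul_mem hv (bpow_mem h.mem f)
  have hx : v * bpow z f ≠ 1 ∧ v * bpow z f ≠ z := by
    cases f
    · simpa [bpow] using ⟨hv1, hvz⟩
    · refine ⟨fun h1 => hvz ?_, fun h1 => hv1 ?_⟩
      · rw [bpow, cond_true] at h1
        rw [eq_inv_of_mul_eq_one_left h1]
        exact inv_eq_of_mul_eq_one_left h.sq
      · simpa [bpow] using h1
  refine ⟨b', v * bpow z f, hb', hr, h.enc_surjective hbord hr hxV hx.1 hx.2, ?_, ?_⟩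
  · have henc : enc b' (v * bpow z f) z ((false, false, false, e), 1) = bpow z e * b' := by
      simp [enc, encVec, bpow]
    rw [henc]
    rcases hb' with rfl | rfl
    · exact hS
    · have hinv : bpow z e * b⁻¹ = (bpow z e * b)⁻¹ := by
        rw [mul_inv_rev, ← eq_inv_of_mul_eq_one_left (hz2 e)]
        cases e
        · simp [bpow]
        · exact (h.comm _).eq
      rw [hinv]
      rcases hS with hS | hS
      · exact Or.inr (by simpa using hS)
      · exact Or.inl hS
  · obtain ⟨j, hj⟩ : ∃ j : Fin 7, b' ^ (j : ℕ) = b ^ (i : ℕ) := by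
      rcases hb' with rfl | rfl
      · exact ⟨i, rfl⟩
      · refine ⟨-i, ?_⟩
        have h1 := pow_fin_add (b := b⁻¹) hr.b_pow (-i) i
        rw [neg_add_cancel, Fin.val_zero, pow_zero] at h1
        rw [eq_inv_of_mul_eq_one_left h1.symm, inv_pow, inv_inv]
    refine ⟨f, j, ?_⟩
    have henc : enc b' (v * bpow z f) z ((true, false, false, f), j) =
        v * bpow z f * bpow z f * b' ^ (j : ℕ) := by
      simp [enc, encVec, bpow]
    rw [henc, mul_assoc v, hz2, mul_one, hj, hi]

theorem Setting.centralizer_ne_top (h : Setting z V) {b : G} (hb : orderOf b = 7) :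
    centralizer {b} ≠ (⊤ : Subgroup G) := by
  intro htop
  have := card_centralizer_dvd h.card h.nonnormal hb
  rw [htop, card_top, h.card] at this
  exact absurd this (by norm_num)

/-- `α` generates the multiplicative group of 𝔽₈. -/
theorem exists_rot_iterate : ∀ p q r : Bool, (p, q, r) ≠ (false, false, false) →
    ∃ i : Fin 7, Vec.rot^[i] (true, false, false, false) = (p, q, r, false) := by
  decide +kernel

end

end SylowSevenNonnormal

/-! ### Choice of generators and conclusion -/

open SylowSevenNonnormal in
theorem proposition3p8 {G : Type*} [Group G] [Fintype G] [DecidableEq G]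
    (hG : Fintype.card G = 112)
    (hnormal : ∀ P : Sylow 7 G, ¬ (P : Subgroup G).Normal)
    (S : Set G) (hS : (SimpleGraph.mulCayley S).Connected) :
    (SimpleGraph.mulCayley S).IsHamiltonian := by
  have hG' : Nat.card G = 112 := by rw [Nat.card_eq_fintype_card, hG]
  obtain ⟨z, hz2, hz1, hzc, V, hVn, hV, hzV⟩ := hasCentralInvolution hG' hnormal
  have h : Setting z V := ⟨hG', hnormal, hz2, hz1, hzc, hVn, hV, hzV⟩
  have hVtop : V ≠ ⊤ := by
    rintro rfl
    rw [Subgroup.card_top, hG'] at hV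
    exact absurd hV (by norm_num)
  obtain ⟨a, haS, haV⟩ := exists_notMem_of_connected hS hVtop
  obtain ⟨b, hb, e, rfl⟩ := h.exists_eq_bpow_mul haV
  obtain ⟨t, htS, htb⟩ := exists_notMem_of_connected hS (h.centralizer_ne_top hb)
  rw [Subgroup.mem_centralizer_singleton_iff] at htb
  obtain ⟨b', x, hb', hr, hsurj, ha', f, j, ht'⟩ := h.exists_rel_of_pair hb e htb (Or.inl haS)
  have ht'' : enc b' x z ((true, false, false, f), j) ∈ S ∪ S⁻¹ := ht' ▸ Or.inl htS
  by_cases hef : e = true ∨ f = true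
  · exact mulCayley_isHamiltonian_of_rel hG hr hsurj S e f j ha' ht'' (by tauto)
  obtain ⟨rfl, rfl⟩ : e = false ∧ f = false := by simpa using hef
  have hbord : orderOf b' = 7 := by
    rcases hb' with rfl | rfl
    · exact hb
    · rw [orderOf_inv, hb]
  -- Here both chosen generators lie in the proper subgroup with vanishing 𝔽₂-coordinate, so `S` has
  -- an element outside it.
  obtain ⟨c, hcS, hc⟩ := exists_notMem_of_connected hS (encRangeZero_ne_top hr hG')
  obtain ⟨⟨⟨p, q, r, s⟩, k⟩, rfl⟩ := hsurj c
  obtain rfl : s = true := by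
    by_contra hs
    exact hc ⟨_, Bool.eq_false_of_not_eq_true hs, rfl⟩
  by_cases hpqr : (p, q, r) = (false, false, false)
  · obtain ⟨rfl, rfl, rfl⟩ : p = false ∧ q = false ∧ r = false := by simpa using hpqr
    have henc : enc b' x z ((false, false, false, true), k) = bpow z true * b' ^ (k : ℕ) := by
      simp [enc, encVec, bpow]
    rw [henc] at hcS
    by_cases hk : k = 0
    · subst hk
      refine mulCayley_isHamiltonian_of_rel hG hr hsurj S false false j ha' ht'' ?_
      exact Or.inr (Or.inr (Or.inl (by simpa [bpow] using hcS)))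
    -- Now `c = z * b' ^ k` with `b' ^ k` of order 7, so `c` replaces the first generator, giving `e
    -- = true`.
    · have hk7 : ¬ 7 ∣ (k : ℕ) := by
        intro hdvd
        exact hk (Fin.ext (Nat.eq_zero_of_dvd_of_lt hdvd k.2))
      have hbk : orderOf (b' ^ (k : ℕ)) = 7 := by
        rw [orderOf_pow, hbord, (Nat.Prime.coprime_iff_not_dvd (by norm_num)).2 hk7]
      have htk : t * b' ^ (k : ℕ) ≠ b' ^ (k : ℕ) * t := by
        intro hcomm
        have h1 : (MulAut.conj b' ^ (k : ℕ)) t = t := by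
          rw [conj_pow_apply, ← hcomm, mul_inv_cancel_right]
        have h2 := apply_eq_self_of_pow_apply (conj_pow_seven hbord) hk7 h1
        have h3 : Commute b' t := mul_inv_eq_iff_eq_mul.1 h2
        apply htb
        rcases hb' with rfl | rfl
        · exact h3.eq.symm
        · exact (Commute.inv_left_iff.1 h3).eq.symm
      obtain ⟨b₂, x₂, -, hr₂, hsurj₂, ha₂, f₂, j₂, ht₂⟩ :=
        h.exists_rel_of_pair hbk true htk (Or.inl hcS)
      exact mulCayley_isHamiltonian_of_rel hG hr₂ hsurj₂ S true f₂ j₂ ha₂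
        (ht₂ ▸ Or.inl htS) (Or.inl rfl)
  -- The 𝔽₈-part of `c` is a conjugate of `x` by a power of `b'`. With that conjugate in the role of
  -- `x`, `c` replaces `t`, giving `f = true`.
  · obtain ⟨i, hi⟩ := exists_rot_iterate p q r hpqr
    have hy : encVec b' x z (p, q, r, false) = b' ^ (i : ℕ) * x * (b' ^ (i : ℕ))⁻¹ := by
      rw [← hi, encVec_rot_iterate hr]
      simp [encVec, bpow]
    have hr' := hr.conj_pow i
    have hsurj' : Function.Surjective (enc b' (b' ^ (i : ℕ) * x * (b' ^ (i : ℕ))⁻¹) z) := by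
      intro g
      obtain ⟨m, rfl⟩ := hsurj g
      have hbR := left_mem_encRange hr'
      refine enc_mem hbR ?_ (right_mem_encRange hr') m
      have h1 := mul_mem (mul_mem (inv_mem (pow_mem hbR i)) (mid_mem_encRange hr'))
        (pow_mem hbR (i : ℕ))
      have h2 : (b' ^ (i : ℕ))⁻¹ * (b' ^ (i : ℕ) * x * (b' ^ (i : ℕ))⁻¹) * b' ^ (i : ℕ) = x := by
        group
      rwa [h2] at h1
    refine mulCayley_isHamiltonian_of_rel hG hr' hsurj' S false true k ?_ ?_ (Or.inr (Or.inl rfl))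
    · simpa [enc, encVec, bpow] using ha'
    · have : enc b' (b' ^ (i : ℕ) * x * (b' ^ (i : ℕ))⁻¹) z ((true, false, false, true), k) =
          enc b' x z ((p, q, r, true), k) := by
        have h1 : encVec b' x z (p, q, r, true) = encVec b' x z (p, q, r, false) * z := by
          simp [encVec, bpow]
        simp only [enc]
        rw [h1, hy]
        simp [encVec, bpow]
      rw [this]
      exact Or.inl hcS
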